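/- Let $L,M\ge 1$ be integers, let $a,b\ge 0$ be integers with $a+b=L$, and let $\mu$ be a continuous (atomless) probability distribution on $\mathbb C$. For each $K$, consider the $K$-user locally connected channel $$Y_i(t)=\sum_{j=1}^K H_{ij}X_j(t)+Z_i(t),\qquad i\in[K],$$ in which transmitter $j$ is connected to the receivers $j-b,\dots,j+a$ in $[K]$, i.e. $H_{ij}=0$ unless $j-b\le i\le j+a$. The remaining coefficients are independent with law $\mu$ and stay fixed during the communication, and the noise variables $Z_i(t)$ are i.i.d. circularly symmetric complex Gaussian of mean zero and unit variance. (The usual locally connected model is $a=\lceil L/2\rceil$, $b=\lfloor L/2\rfloor$; the model in which each transmitter is connected to its own and the $L$ succeeding receivers is $a=L$, $b=0$.) The independent, uniformly distributed messages $W_i$ are known to transmit sets $\mathcal T_i\subseteq[K]$ with $|\mathcal T_i|\le M$. The transmit sets do not depend on the channel realization, while codes may depend on it. In a zero-forcing code of block length $n$ the signals are $X_j=\sum_{i:\,j\in\mathcal T_i}X_{j,i}$, where $X_{j,i}\in\mathbb C^n$ is a function of $W_i$ only, each transmitter has average power at most $P$, and, with $\tilde Y_j=Y_j-Z_j\in\mathbb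 C^n$, for every $j$ either $I(\tilde Y_j;W_j)=0$, or $W_j$ completely determines $\tilde Y_j$. Receiver $j$ is called active if $I(\tilde Y_j;W_j)>0$, and active in channel use $t$ if $I(\tilde Y_j(t);W_j)>0$. Receiver $i$ decodes $W_i$ from $Y_i$ alone. A tuple $d\in\{0,1\}^K$ is achieved by zero-forcing with the given transmit sets (each message is allocated one degree of freedom or is not transmitted) if for almost every channel realization there are rates $R_i(P)$ with $\lim_{P\to\infty}R_i(P)/\log P=d_i$ such that for every $P>0$, every $\varepsilon>0$ and all sufficiently large $n$ there is a zero-forcing code of block length $n$ and power $P$ with at least $e^{nR_i(P)}$ messages for each user $i$, with decoding error probability at most $\varepsilon$ for every message, and with $d_j=1$ for every active receiver $j$. Let $\eta^{(\mathrm{zf})}_L(K,M)$ be the maximum of $\sum_i d_i$ over all transmit sets with $|\mathcal T_i|\le M$ and all tuples $d$ achieved by zero-forcing. Then $$\tau_L^{(\mathrm{zf})}(M)=\lim_{K\to\infty}\frac{\eta^{(\mathrm{zf})}_L(K,M)}{K}=\frac{2M}{2M+L}.$$ Moreover, for every $K$ and almost every channel realization, for all transmit sets with $|\mathcal T_i|\le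 M$ and every zero-forcing code (of any block length and power), in each channel use any $2M+L$ consecutive users contain at most $2M$ active ones. -/

import Mathlib

open MeasureTheory ProbabilityTheory Filter Topology
open scoped ENNReal NNReal

namespace CoMP

/-- Mutual information `I(X;Y)` (in nats): the Kullback-Leibler divergence of the joint law from the
product of the marginal laws. -/
noncomputable def mutualInfo {Ω α β : Type*} [MeasurableSpace Ω] [MeasurableSpace α]
    [MeasurableSpace β] (X : Ω → α) (Y : Ω → β) (ρ : Measure Ω) : ℝ≥0∞ :=
  InformationTheory.klDiv (ρ.map fun ω => (X ω, Y ω)) ((ρ.map X).prod (ρ.map Y))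

/-- Circularly symmetric complex Gaussian noise with mean zero and unit variance: independent real
and imaginary parts of variance `1/2`. -/
noncomputable def complexGaussian : Measure ℂ :=
  ((gaussianReal 0 (1 / 2 : ℝ≥0)).prod (gaussianReal 0 (1 / 2 : ℝ≥0))).map
    fun p => (⟨p.1, p.2⟩ : ℂ)

/-- The law of an array of `K * K` independent coefficients with common distribution `μ`. The entry
`H i j` is the coefficient from transmitter `j` to receiver `i`. -/
noncomputable def coeffLaw (K : ℕ) (μ : Measure ℂ) : Measure (Fin K → Fin K → ℂ) :=
  Measure.pi fun _ => Measure.pi fun _ => μ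

/-- The locally connected channel matrix: transmitter `j` is connected to the receivers
`j - b, …, j + a` (as far as they exist), and all other coefficients are zero. -/
def localChannel (a b : ℕ) {K : ℕ} (H : Fin K → Fin K → ℂ) (i j : Fin K) : ℂ :=
  if (i : ℕ) ≤ j + a ∧ (j : ℕ) ≤ i + b then H i j else 0

/-- A linear precoding block code of length `n` for `K` users. The message `W_i` takes values in
`Fin (card i)`; `beam k i` is the part `X_{k,i}` of the signal of transmitter `k` that depends only
on `W_i`; `dec i` is the decoder of receiver `i`. -/
structure Code (K n : ℕ) where
  card : Fin K → ℕ
  card_pos : ∀ i, 0 < card i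
  beam : Fin K → (i : Fin K) → Fin (card i) → Fin n → ℂ
  dec : (i : Fin K) → (Fin n → ℂ) → Fin (card i)
  measurable_dec : ∀ i, Measurable (dec i)

namespace Code

variable {K n : ℕ}

/-- A tuple `(W_1, …, W_K)` of messages. -/
abbrev Msg (c : Code K n) : Type := (i : Fin K) → Fin (c.card i)

/-- The messages are independent and uniformly distributed. -/
noncomputable def msgLaw (c : Code K n) : Measure c.Msg :=
  Measure.pi fun i => uniformOn (Set.univ : Set (Fin (c.card i)))

/-- The signal `X_k = ∑_{i : k ∈ T_i} X_{k,i}` of transmitter `k` when `T i` is the set of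
transmitters that know `W_i`. -/
noncomputable def tx (c : Code K n) (T : Fin K → Finset (Fin K)) (w : c.Msg) (k : Fin K) :
    Fin n → ℂ :=
  fun t => ∑ i with k ∈ T i, c.beam k i (w i) t

/-- The noiseless received signal `Ỹ_j = Y_j - Z_j` for the channel matrix `G`. -/
noncomputable def noiseless (c : Code K n) (T : Fin K → Finset (Fin K)) (G : Fin K → Fin K → ℂ)
    (j : Fin K) (w : c.Msg) : Fin n → ℂ :=
  fun t => ∑ k, G j k * c.tx T w k t

/-- The average transmit power of each transmitter is at most `P`. -/
def PowerConstraint (c : Code K n) (T : Fin K → Finset (Fin K)) (P : ℝ) : Prop :=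
  ∀ k, ∫ w, (∑ t, ‖c.tx T w k t‖ ^ 2) ∂c.msgLaw ≤ n * P

/-- The probability that receiver `i` decodes `W_i` incorrectly from `Y_i = Ỹ_i + Z_i`. -/
noncomputable def errorProb (c : Code K n) (T : Fin K → Finset (Fin K)) (G : Fin K → Fin K → ℂ)
    (i : Fin K) : ℝ≥0∞ :=
  (c.msgLaw.prod (Measure.pi fun _ : Fin n => complexGaussian))
    {p | c.dec i (c.noiseless T G i p.1 + p.2) ≠ p.1 i}

/-- Receiver `j` is active: `I(Ỹ_j; W_j) > 0`. -/
def Active (c : Code K n) (T : Fin K → Finset (Fin K)) (G : Fin K → Fin K → ℂ) (j : Fin K) :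
    Prop :=
  0 < mutualInfo (c.noiseless T G j) (fun w => w j) c.msgLaw

/-- Receiver `j` is active in the channel use `t`: `I(Ỹ_j(t); W_j) > 0`. -/
def ActiveAt (c : Code K n) (T : Fin K → Finset (Fin K)) (G : Fin K → Fin K → ℂ) (t : Fin n)
    (j : Fin K) : Prop :=
  0 < mutualInfo (fun w => c.noiseless T G j w t) (fun w => w j) c.msgLaw

/-- Zero-forcing (interference avoidance): for each receiver `j`, either `I(Ỹ_j; W_j) = 0`, or
`W_j` completely determines `Ỹ_j`. -/
def IsZeroForcing (c : Code K n) (T : Fin K → Finset (Fin K)) (G : Fin K → Fin K → ℂ) : Prop :=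
  ∀ j, mutualInfo (c.noiseless T G j) (fun w => w j) c.msgLaw = 0 ∨
    ∃ f : Fin (c.card j) → Fin n → ℂ, ∀ w, c.noiseless T G j w = f (w j)

end Code

/-- The rates `R` (in nats per channel use) are achievable over the channel matrix `G` at power `P`
by zero-forcing codes whose active receivers all lie in the set `A`. -/
def ZFRatesAchievable {K : ℕ} (T : Fin K → Finset (Fin K)) (G : Fin K → Fin K → ℂ)
    (A : Set (Fin K)) (P : ℝ) (R : Fin K → ℝ) : Prop :=
  ∀ ε : ℝ≥0∞, 0 < ε → ∃ N : ℕ, ∀ n ≥ N, ∃ c : Code K n,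
    (∀ i, Real.exp (n * R i) ≤ c.card i) ∧ c.PowerConstraint T P ∧ c.IsZeroForcing T G ∧
    (∀ j, c.Active T G j → j ∈ A) ∧ ∀ i, c.errorProb T G i ≤ ε

/-- The degrees-of-freedom tuple `d` is achieved by zero-forcing schemes with transmit sets `T`:
each message is allocated one degree of freedom or is not transmitted, and for almost all
channel realizations there are achievable rates `R_i(P)` with `R_i(P) / log P → d_i`. -/
def ZFDoFAchievable (a b : ℕ) (μ : Measure ℂ) {K : ℕ} (T : Fin K → Finset (Fin K))
    (d : Fin K → ℝ) : Prop :=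
  (∀ i, d i = 0 ∨ d i = 1) ∧
  ∀ᵐ H ∂coeffLaw K μ, ∃ R : ℝ → Fin K → ℝ,
    (∀ P > 0, ZFRatesAchievable T (localChannel a b H) {i | d i = 1} P (R P)) ∧
    ∀ i, Tendsto (fun P => R P i / Real.log P) atTop (𝓝 (d i))

/-- The best sum of degrees of freedom of the `K`-user channel under zero-forcing, over all transmit
sets of size at most `M`. (It is the largest element of a nonempty finite set.) -/
noncomputable def zfDoF (a b M : ℕ) (μ : Measure ℂ) (K : ℕ) : ℝ :=
  sSup {s | ∃ (T : Fin K → Finset (Fin K)) (d : Fin K → ℝ),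
    (∀ i, (T i).card ≤ M) ∧ ZFDoFAchievable a b μ T d ∧ s = ∑ i, d i}

end CoMP

/-!
The coefficients of almost every channel realization are algebraically independent over `ℚ`
(`ae_coeffLaw_algebraicIndependent`), and all statements about almost every realization follow from
this algebraic fact.

*Activity in one channel use.* If receiver `i` is active in a channel use, two values of `W_i` give
different signals there; the difference of the two transmitted signals is a beam of at most `M`
transmitters which is seen by receiver `i` and by no other active receiver. For generic coefficients
the support of such a beam meets at most as many active receivers as it has elements, since the
equations would otherwise overdetermine the beam (`card_lt_of_kernel`). If a window of `2 * M + L`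
users contained `2 * M + 1` active ones, the beam of a middle one would meet more active receivers
than that (`not_exists_sparse_zeroForcing`), whence `card_activeAt_window_le`.

*Converse.* The number of messages of a user is at most `2 * (1 + P) ^ m * exp (O(n))`, where `m` is
the number of channel uses in which its receiver is active (`Code.IsZeroForcing.card_le`): all
output laws are dominated by a multiple of a single Gaussian law. Since the numbers `m` of the users in a
window add up to at most `2 * M * n`, the degrees of freedom of a window add up to at most `2 * M`.

*Achievability.* Each block of `2 * M + L` users serves its first `M` and its last `M` users, by two
groups of `M` transmitters whose channels do not interfere with each other or with other blocks, and
whose channel matrices are triangular with nonzero diagonal (`isBeamforming_schemeBeam`). Inverting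
these matrices leaves each served user with a Gaussian channel free of interference, on which a
sphere-packing code with minimum-distance decoding has rate `log P - O(1)`
(`IsBeamforming.exists_code`).

Hence `zfDoF a b M μ K` differs from `2 * M * K / (2 * M + L)` by a bounded amount.
-/

namespace CoMP

/-! ### Genericity of the channel coefficients -/

/-- The zero set of a nonzero polynomial is a null set for a power of an atomless measure. -/
theorem ae_pi_eval_ne_zero (μ : Measure ℂ) [IsProbabilityMeasure μ] [NullSingletonClass μ] {n : ℕ}
    (p : MvPolynomial (Fin n) ℂ) (hp : p ≠ 0) :
    ∀ᵐ x ∂Measure.pi (fun _ : Fin n => μ), MvPolynomial.eval x p ≠ 0 := by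
  induction n with
  | zero =>
    obtain ⟨c, rfl⟩ := MvPolynomial.C_surjective (Fin 0) p
    refine ae_of_all _ fun x => ?_
    simpa using hp
  | succ n ih =>
    have hq : MvPolynomial.finSuccEquiv ℂ n p ≠ 0 := by simpa using hp
    set q := MvPolynomial.finSuccEquiv ℂ n p with hqdef
    have hlead := ih q.leadingCoeff (Polynomial.leadingCoeff_ne_zero.2 hq)
    have hmeas : MeasurableSet {z : (Fin n → ℂ) × ℂ |
        MvPolynomial.eval (Fin.cons z.2 z.1 : Fin (n + 1) → ℂ) p ≠ 0} := by
      have hc : Continuous fun z : (Fin n → ℂ) × ℂ =>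
          MvPolynomial.eval (Fin.cons z.2 z.1 : Fin (n + 1) → ℂ) p := by
        refine (MvPolynomial.continuous_eval p).comp ?_
        exact continuous_pi fun i => by
          refine Fin.cases ?_ (fun j => ?_) i
          · simpa using continuous_snd
          · simp only [Fin.cons_succ]; fun_prop
      exact (isOpen_ne.preimage hc).measurableSet
    have h1 : ∀ᵐ z ∂(Measure.pi (fun _ : Fin n => μ)).prod μ,
        MvPolynomial.eval (Fin.cons z.2 z.1 : Fin (n + 1) → ℂ) p ≠ 0 := by
      rw [Measure.ae_prod_iff_ae_ae hmeas]
      filter_upwards [hlead] with y hy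
      -- for fixed `y` the remaining one-variable polynomial is nonzero, so has finitely many roots
      have hne : Polynomial.map (MvPolynomial.eval y) q ≠ 0 := by
        intro h0
        apply hy
        have := congrArg (fun r => Polynomial.coeff r q.natDegree) h0
        simpa [Polynomial.coeff_map] using this
      have hfin : {x : ℂ | Polynomial.eval x (Polynomial.map (MvPolynomial.eval y) q) = 0}.Finite :=
        (Polynomial.finite_setOfPred_isRoot hne)
      have hnull := hfin.measure_zero μ
      rw [ae_iff]
      simpa [MvPolynomial.eval_eq_eval_mv_eval', ← hqdef] using hnull
    have hswap := (Measure.measurePreserving_swap (μ := μ)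
      (ν := Measure.pi (fun _ : Fin n => μ))).quasiMeasurePreserving.ae h1
    have h2 := (measurePreserving_piFinSuccAbove (fun _ : Fin (n + 1) => μ) 0
      ).quasiMeasurePreserving.ae hswap
    filter_upwards [h2] with x hx
    convert hx using 2
    congr 1
    ext i
    refine Fin.cases ?_ (fun j => ?_) i
    · rfl
    · simp [MeasurableEquiv.piFinSuccAbove, Fin.insertNthEquiv, Fin.tail]

/-- Almost all channel realizations have algebraically independent coefficients. This is the only
genericity used below, and it does not involve the transmit sets or the code. -/
theorem ae_coeffLaw_algebraicIndependent (K : ℕ) (μ : Measure ℂ) [IsProbabilityMeasure μ]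
    [NullSingletonClass μ] :
    ∀ᵐ H ∂coeffLaw K μ,
      AlgebraicIndependent ℚ (fun e : Fin K × Fin K => H e.1 e.2) := by
  have hcount : Countable (MvPolynomial (Fin K × Fin K) ℚ) := by
    rw [← Cardinal.mk_le_aleph0_iff]
    refine (MvPolynomial.cardinalMk_le_max).trans ?_
    simpa using (Cardinal.mul_lt_aleph0 (Cardinal.natCast_lt_aleph0 (n := K))
      (Cardinal.natCast_lt_aleph0 (n := K))).le
  have key : ∀ p : MvPolynomial (Fin K × Fin K) ℚ, p ≠ 0 →
      ∀ᵐ H ∂coeffLaw K μ, MvPolynomial.aeval (fun e : Fin K × Fin K => H e.1 e.2) p ≠ 0 := by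
    intro p hp
    let e : Fin K × Fin K ≃ Fin (K * K) := finProdFinEquiv
    have hp' : MvPolynomial.rename e (MvPolynomial.map (algebraMap ℚ ℂ) p) ≠ 0 := by
      rw [Ne, map_eq_zero_iff _ (MvPolynomial.rename_injective _ e.injective)]
      rwa [map_eq_zero_iff _ (MvPolynomial.map_injective _ (algebraMap ℚ ℂ).injective)]
    have h1 := ae_pi_eval_ne_zero μ _ hp'
    have h2 := (measurePreserving_piCongrLeft (fun _ : Fin (K * K) => μ) e
      ).quasiMeasurePreserving.ae h1
    have hlaw := Measure.infinitePi_map_curry_symm (fun (_ : Fin K) (_ : Fin K) => μ)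
    simp only [Measure.infinitePi_eq_pi] at hlaw
    rw [← hlaw] at h2
    have h3 := ae_of_ae_map (by fun_prop) h2
    filter_upwards [h3] with H hH
    convert hH using 1
    rw [MvPolynomial.eval_rename, MvPolynomial.eval_map, MvPolynomial.aeval_def]
    congr 1
    ext x
    simp [MeasurableEquiv.piCongrLeft, Function.uncurry]
  have h := (ae_all_iff (ι := {p : MvPolynomial (Fin K × Fin K) ℚ // p ≠ 0})).2
    fun p => key p.1 p.2
  filter_upwards [h] with H hH
  rw [algebraicIndependent_iff]
  intro p hp
  by_contra hne
  exact hH ⟨p, hne⟩ hp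

/-- Transmitter `k` is connected to receiver `j`. -/
def Conn (a b : ℕ) (j k : ℕ) : Prop := j ≤ k + a ∧ k ≤ j + b

/-- Dimension count for the kernel of a generic matrix of given sparsity: if `u` is annihilated by
the rows in `R`, each of which meets the support of `u`, then `R` is smaller than the support. After
normalizing one coordinate of `u` to `1`, each equation expresses one coefficient by the remaining
coefficients and the other coordinates of `u`, so otherwise the transcendence degree of the
coefficients would be smaller than their number. -/
theorem card_lt_of_kernel {a b K : ℕ} {H : Fin K → Fin K → ℂ}
    (hH : AlgebraicIndependent ℚ (fun e : Fin K × Fin K => H e.1 e.2))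
    (u : Fin K → ℂ) (R : Finset (Fin K)) (hu : u ≠ 0)
    (hR : ∀ j ∈ R, ∃ k, u k ≠ 0 ∧ Conn a b j k)
    (h0 : ∀ j ∈ R, ∑ k, localChannel a b H j k * u k = 0) :
    R.card < (Finset.univ.filter fun k => u k ≠ 0).card := by
  classical
  obtain ⟨p₀, hp₀⟩ := Function.ne_iff.1 hu
  simp only [Pi.zero_apply] at hp₀
  choose! p hp hc using hR
  -- the entries solved for, the remaining entries, and the coordinates of the normalized vector
  let h : Fin K × Fin K → ℂ := fun e => H e.1 e.2
  let E₁ : Finset (Fin K × Fin K) := R.image fun j => (j, p j)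
  let v : Fin K → ℂ := fun k => u k / u p₀
  let T := Finset.univ.filter fun k => u k ≠ 0
  let Y : Finset ℂ := (T.erase p₀).image v ∪ (Finset.univ \ E₁).image h
  let 𝓜 := AlgebraicIndependent.matroid ℚ ℂ
  have hcl : 𝓜.closure Y = (Subalgebra.algebraicClosure (Algebra.adjoin ℚ (Y : Set ℂ)) ℂ : Set ℂ) :=
    AlgebraicIndependent.matroid_closure_eq
  have hsub : (Y : Set ℂ) ⊆ 𝓜.closure Y := by
    rw [hcl]
    intro y hy
    exact isAlgebraic_algebraMap (⟨y, Algebra.subset_adjoin hy⟩ : Algebra.adjoin ℚ (Y : Set ℂ))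
  set F := Subalgebra.algebraicClosure (Algebra.adjoin ℚ (Y : Set ℂ)) ℂ with hF
  have hmem : ∀ y ∈ Y, y ∈ F := fun y hy => by
    have := hsub (Finset.mem_coe.2 hy)
    rwa [hcl] at this
  have hv : ∀ k, v k ∈ F := by
    intro k
    by_cases hk : u k = 0
    · simp [v, hk, F.zero_mem]
    · by_cases hk0 : k = p₀
      · subst hk0; simp [v, hk, F.one_mem]
      · exact hmem _ (Finset.mem_union_left _ (Finset.mem_image_of_mem _ (by simp [T, hk, hk0])))
  have hother : ∀ e, e ∉ E₁ → h e ∈ F := fun e he =>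
    hmem _ (Finset.mem_union_right _ (Finset.mem_image_of_mem _ (by simpa using he)))
  have hrange : Set.range h ⊆ 𝓜.closure Y := by
    rw [hcl]
    rintro _ ⟨e, rfl⟩
    by_cases he : e ∈ E₁
    · obtain ⟨j, hj, rfl⟩ := Finset.mem_image.1 he
      have hvp : v (p j) ≠ 0 := div_ne_zero (hp j hj) hp₀
      have hsum : ∑ k, localChannel a b H j k * v k = 0 := by
        have := h0 j hj
        simp only [v, mul_div_assoc', ← Finset.sum_div, this, zero_div]
      rw [← Finset.add_sum_erase _ _ (Finset.mem_univ (p j))] at hsum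
      have hloc : localChannel a b H j (p j) = h (j, p j) := by
        simp only [localChannel, h]
        exact if_pos (hc j hj)
      rw [hloc] at hsum
      have hrest : ∑ k ∈ Finset.univ.erase (p j), localChannel a b H j k * v k ∈ F := by
        refine F.sum_mem fun k hk => F.mul_mem ?_ (hv k)
        simp only [localChannel]
        split_ifs
        · refine hother (j, k) fun hmem' => ?_
          obtain ⟨j', -, hj'⟩ := Finset.mem_image.1 hmem'
          have h1 := (Prod.ext_iff.1 hj').1
          have h2 := (Prod.ext_iff.1 hj').2
          simp only at h1 h2
          subst h1
          exact (Finset.mem_erase.1 hk).1 h2.symm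
        · exact F.zero_mem
      have : h (j, p j) =
          -(∑ k ∈ Finset.univ.erase (p j), localChannel a b H j k * v k) * (v (p j))⁻¹ := by
        field_simp
        linear_combination hsum
      rw [this]
      exact F.mul_mem (F.neg_mem hrest) (IsAlgebraic.inv (hv _))
    · exact hother e he
  have hind : 𝓜.Indep (Set.range h) := AlgebraicIndependent.matroid_indep_iff.2 hH.coe_range
  have hinj : Function.Injective h := hH.injective
  have hcard : (Set.range h).encard ≤ (Y : Set ℂ).encard := by
    calc (Set.range h).encard ≤ 𝓜.eRk (𝓜.closure Y) := hind.encard_le_eRk_of_subset hrange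
      _ = 𝓜.eRk Y := 𝓜.eRk_closure_eq _
      _ ≤ _ := 𝓜.eRk_le_encard _
  have hE₁ : E₁.card = R.card :=
    Finset.card_image_of_injective _ fun i j hij => (Prod.ext_iff.1 hij).1
  rw [← Set.image_univ, hinj.encard_image, Set.encard_coe_eq_coe_finsetCard] at hcard
  have hcard' : Fintype.card (Fin K × Fin K) ≤ Y.card := by
    have : (Set.univ : Set (Fin K × Fin K)).encard = (Fintype.card (Fin K × Fin K) : ℕ∞) := by
      simp [Set.encard_univ]
    rw [this] at hcard
    exact_mod_cast hcard
  have hY : Y.card ≤ (T.card - 1) + (Fintype.card (Fin K × Fin K) - R.card) := by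
    refine (Finset.card_union_le _ _).trans (add_le_add ?_ ?_)
    · refine Finset.card_image_le.trans ?_
      rw [Finset.card_erase_of_mem (by simp [T, hp₀])]
    · refine Finset.card_image_le.trans ?_
      rw [Finset.card_sdiff_of_subset (Finset.subset_univ _), hE₁, Finset.card_univ]
  have hT : 0 < T.card := Finset.card_pos.2 ⟨p₀, by simp [T, hp₀]⟩
  have hRle : R.card ≤ Fintype.card (Fin K × Fin K) := hE₁ ▸ Finset.card_le_univ E₁
  change R.card < T.card
  omega

/-! ### Sparse zero-forcing vectors in a window of receivers -/

theorem localChannel_eq_zero {a b K : ℕ} (H : Fin K → Fin K → ℂ) {j k : Fin K}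
    (h : ¬ Conn a b j k) : localChannel a b H j k = 0 := if_neg h

open scoped Pointwise in
/-- Let more than `2 * M` receivers in a window of `2 * M + (a + b)` receivers be given, and let `i`
be a middle one of them. No beam of at most `M` transmitters reaches receiver `i` and is invisible
at the other given receivers.

For a beam of minimal support the connected receivers form an interval. If it leaves the window, the
support meets all given receivers on one side of `i`, which are at least `M + 1`. If it stays in the
window, then `m` transmitters are connected to at least `m + a + b` positions of the window, of
which at least `m + 1` are given. Both contradict the dimension count `card_lt_of_kernel`. -/
theorem not_exists_sparse_zeroForcing {a b M s K : ℕ} {H : Fin K → Fin K → ℂ}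
    (hH : AlgebraicIndependent ℚ (fun e : Fin K × Fin K => H e.1 e.2))
    {S : Finset (Fin K)} (hS : ∀ j ∈ S, s ≤ (j : ℕ) ∧ (j : ℕ) < s + (2 * M + (a + b)))
    {i : Fin K} (hi : i ∈ S) (hlo : M + 1 ≤ (S.filter fun j => j ≤ i).card)
    (hhi : M + 1 ≤ (S.filter fun j => i ≤ j).card)
    (u : Fin K → ℂ) (hsupp : (Finset.univ.filter fun k => u k ≠ 0).card ≤ M)
    (hker : ∀ j ∈ S, j ≠ i → ∑ k, localChannel a b H j k * u k = 0)
    (hne : ∑ k, localChannel a b H i k * u k ≠ 0) : False := by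
  classical
  induction hm : (Finset.univ.filter fun k => u k ≠ 0).card using Nat.strong_induction_on
    generalizing u with
  | _ m ih =>
  subst hm
  have touch_i : ∃ k, u k ≠ 0 ∧ Conn a b i k := by
    by_contra! hcon
    refine hne (Finset.sum_eq_zero fun k _ => ?_)
    by_cases hk : u k = 0
    · simp [hk]
    · simp [localChannel_eq_zero H (hcon k hk)]
  -- A restriction of `u` to fewer transmitters with the same effect at `i`, and none at the other
  -- given receivers, contradicts the induction hypothesis.
  have restrict : ∀ D : Fin K → Prop, (∀ j, (∑ k, localChannel a b H j k * (if D k then u k else 0)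
        = ∑ k, localChannel a b H j k * u k) ∨
        (j ≠ i ∧ ∑ k, localChannel a b H j k * (if D k then u k else 0) = 0)) →
      (∃ k, u k ≠ 0 ∧ ¬ D k) → False := by
    rintro D hD ⟨k₀, hk₀, hDk₀⟩
    have hlt : (Finset.univ.filter fun k => (if D k then u k else 0) ≠ 0).card <
        (Finset.univ.filter fun k => u k ≠ 0).card := by
      refine Finset.card_lt_card (Finset.ssubset_iff_of_subset ?_ |>.2 ⟨k₀, ?_, ?_⟩)
      · intro k
        simp only [Finset.mem_filter, Finset.mem_univ, true_and]
        intro h h0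
        simp [h0] at h
      · simpa using hk₀
      · simp [hDk₀]
    refine ih _ hlt _ (hlt.le.trans hsupp) (fun j hj hji => ?_) ?_ rfl
    · rcases hD j with h | h
      · rw [h, hker j hj hji]
      · exact h.2
    · rcases hD i with h | h
      · rwa [h]
      · exact absurd rfl h.1
  -- A receiver `g` that hears no transmitter of the support separates the support into two parts;
  -- only the part on the side of `i` is needed.
  have sepB : ∀ g : Fin K, g ≤ i → (∀ k, u k ≠ 0 → ¬ Conn a b g k) →
      ∀ k₀ : Fin K, u k₀ ≠ 0 → (k₀ : ℕ) ≤ g + b → False := by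
    intro g hgi hg k₀ hk₀ hle
    refine restrict (fun k => (g : ℕ) + b < k) (fun j => ?_) ⟨k₀, hk₀, by omega⟩
    rcases lt_or_ge j g with hjg | hjg
    · refine Or.inr ⟨(hjg.trans_le hgi).ne, Finset.sum_eq_zero fun k _ => ?_⟩
      have hjg' : (j : ℕ) < g := hjg
      split_ifs with hk
      · rw [localChannel_eq_zero H (by rintro ⟨-, h⟩; omega), zero_mul]
      · simp
    · refine Or.inl (Finset.sum_congr rfl fun k _ => ?_)
      have hjg' : (g : ℕ) ≤ j := hjg
      split_ifs with hk
      · rfl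
      · by_cases huk : u k = 0
        · simp [huk]
        · have := hg k huk
          rw [localChannel_eq_zero H (by unfold Conn at *; omega), zero_mul, zero_mul]
  have sepA : ∀ g : Fin K, i ≤ g → (∀ k, u k ≠ 0 → ¬ Conn a b g k) →
      ∀ k₀ : Fin K, u k₀ ≠ 0 → (g : ℕ) ≤ k₀ + a → False := by
    intro g hgi hg k₀ hk₀ hle
    refine restrict (fun k => (k : ℕ) + a < g) (fun j => ?_) ⟨k₀, hk₀, by omega⟩
    rcases lt_or_ge g j with hjg | hjg
    · refine Or.inr ⟨(hgi.trans_lt hjg).ne', Finset.sum_eq_zero fun k _ => ?_⟩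
      have hjg' : (g : ℕ) < j := hjg
      split_ifs with hk
      · rw [localChannel_eq_zero H (by rintro ⟨h, -⟩; omega), zero_mul]
      · simp
    · refine Or.inl (Finset.sum_congr rfl fun k _ => ?_)
      have hjg' : (j : ℕ) ≤ g := hjg
      split_ifs with hk
      · rfl
      · by_cases huk : u k = 0
        · simp [huk]
        · have := hg k huk
          rw [localChannel_eq_zero H (by unfold Conn at *; omega), zero_mul, zero_mul]
  set T := Finset.univ.filter fun k => u k ≠ 0 with hT
  set R' := S.filter fun j : Fin K => ∃ k : Fin K, u k ≠ 0 ∧ Conn a b j k with hR'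
  have hiR : i ∈ R' := Finset.mem_filter.2 ⟨hi, touch_i⟩
  have hR'card : R'.card ≤ T.card := by
    have h := card_lt_of_kernel hH u (R'.erase i)
      (fun h0 => by obtain ⟨k, hk, -⟩ := touch_i; exact hk (by simp [h0]))
      (fun j hj => (Finset.mem_filter.1 (Finset.mem_of_mem_erase hj)).2)
      (fun j hj => hker j (Finset.mem_filter.1 (Finset.mem_of_mem_erase hj)).1
        (Finset.ne_of_mem_erase hj))
    rw [Finset.card_erase_of_mem hiR] at h
    change R'.card - 1 < T.card at h
    omega
  by_cases hA : ∃ k₀, u k₀ ≠ 0 ∧ (k₀ : ℕ) < s + b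
  · -- the support reaches beyond the lower end of the window
    obtain ⟨k₀, hk₀, hlt⟩ := hA
    have hsub : (S.filter fun j => j ≤ i) ⊆ R' := by
      intro j hj
      obtain ⟨hjS, hji⟩ := Finset.mem_filter.1 hj
      refine Finset.mem_filter.2 ⟨hjS, ?_⟩
      by_contra! hcon
      exact sepB j hji hcon k₀ hk₀ (by have := (hS j hjS).1; omega)
    have := Finset.card_le_card hsub
    omega
  by_cases hB : ∃ k₀, u k₀ ≠ 0 ∧ s + (2 * M + (a + b)) ≤ (k₀ : ℕ) + a
  · -- the support reaches beyond the upper end of the window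
    obtain ⟨k₀, hk₀, hlt⟩ := hB
    have hsub : (S.filter fun j => i ≤ j) ⊆ R' := by
      intro j hj
      obtain ⟨hjS, hji⟩ := Finset.mem_filter.1 hj
      refine Finset.mem_filter.2 ⟨hjS, ?_⟩
      by_contra! hcon
      exact sepA j hji hcon k₀ hk₀ (by have := (hS j hjS).2; omega)
    have := Finset.card_le_card hsub
    omega
  push Not at hA hB
  -- all receivers that hear the support lie in the window; positions are shifted by `b`
  have hScard : 2 * M + 1 ≤ S.card := by
    have h1 : (S.filter fun j => j ≤ i) ∪ (S.filter fun j => i ≤ j) = S := by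
      ext j
      simp only [Finset.mem_union, Finset.mem_filter]
      have := le_total j i
      tauto
    have h2 : (S.filter fun j => j ≤ i) ∩ (S.filter fun j => i ≤ j) ⊆ {i} := by
      intro j hj
      simp only [Finset.mem_inter, Finset.mem_filter] at hj
      exact Finset.mem_singleton.2 (le_antisymm hj.1.2 hj.2.2)
    have h3 := Finset.card_union_add_card_inter (S.filter fun j => j ≤ i) (S.filter fun j => i ≤ j)
    have h4 := Finset.card_le_card h2
    rw [h1] at h3
    simp only [Finset.card_singleton] at h4
    omega
  let A : Finset ℕ := T.image fun k : Fin K => (k : ℕ)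
  let B : Finset ℕ := Finset.range (a + b + 1)
  let S' : Finset ℕ := S.image fun j : Fin K => (j : ℕ) + b
  let W : Finset ℕ := Finset.Ico (s + b) (s + b + (2 * M + (a + b)))
  have hAcard : A.card = T.card := Finset.card_image_of_injective T Fin.val_injective
  have hS'card : S'.card = S.card := Finset.card_image_of_injective S fun x y h => by
    simpa [Fin.ext_iff] using h
  have hAne : A.Nonempty := by
    obtain ⟨k, hk, -⟩ := touch_i
    exact ⟨k, Finset.mem_image_of_mem _ (by simpa [hT] using hk)⟩
  have hCD : A.card + B.card - 1 ≤ (A + B).card :=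
    cauchy_davenport_add_of_linearOrder_isCancelAdd hAne (by simp [B])
  have hABW : A + B ⊆ W := by
    intro x hx
    obtain ⟨y, hy, z, hz, rfl⟩ := Finset.mem_add.1 hx
    obtain ⟨k, hk, rfl⟩ := Finset.mem_image.1 hy
    have hk' : u k ≠ 0 := by simpa [hT] using hk
    have h1 := hA k hk'
    have h2 := hB k hk'
    have hz' := Finset.mem_range.1 hz
    exact Finset.mem_Ico.2 ⟨by omega, by omega⟩
  have hSW : S' ⊆ W := by
    intro x hx
    obtain ⟨j, hj, rfl⟩ := Finset.mem_image.1 hx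
    have := hS j hj
    exact Finset.mem_Ico.2 ⟨by omega, by omega⟩
  have hinter : ((A + B) ∩ S').card ≤ R'.card := by
    refine (Finset.card_le_card (t := R'.image fun j : Fin K => (j : ℕ) + b) ?_).trans
      Finset.card_image_le
    intro x hx
    obtain ⟨hx1, hx2⟩ := Finset.mem_inter.1 hx
    obtain ⟨y, hy, z, hz, rfl⟩ := Finset.mem_add.1 hx1
    obtain ⟨k, hk, rfl⟩ := Finset.mem_image.1 hy
    obtain ⟨j, hj, hjx⟩ := Finset.mem_image.1 hx2
    have hz' := Finset.mem_range.1 hz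
    refine Finset.mem_image.2 ⟨j, Finset.mem_filter.2 ⟨hj, k, by simpa [hT] using hk, ?_⟩, hjx⟩
    exact ⟨by omega, by omega⟩
  have h1 := Finset.card_union_add_card_inter (A + B) S'
  have h2 := Finset.card_le_card (Finset.union_subset hABW hSW)
  have h3 : W.card = 2 * M + (a + b) := by simp [W]
  have h4 : B.card = a + b + 1 := by simp [B]
  omega

/-- A median of `S`. -/
theorem exists_middle {K M : ℕ} (S : Finset (Fin K)) (h : 2 * M + 1 ≤ S.card) :
    ∃ i ∈ S, M + 1 ≤ (S.filter fun j => j ≤ i).card ∧ M + 1 ≤ (S.filter fun j => i ≤ j).card := by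
  obtain ⟨S', hS', hc⟩ := Finset.exists_subset_card_eq h
  let e := S'.orderIsoOfFin hc
  let i := e ⟨M, by omega⟩
  refine ⟨i, hS' i.2, ?_, ?_⟩
  · calc M + 1 = (Finset.Iic (⟨M, by omega⟩ : Fin (2 * M + 1))).card := by simp
      _ ≤ _ := Finset.card_le_card_of_injOn (fun x => (e x : Fin K)) (fun x hx => ?_)
        (fun x _ y _ hxy => e.injective (Subtype.ext hxy))
    have hx' : x ≤ (⟨M, by omega⟩ : Fin (2 * M + 1)) := by simpa using hx
    simpa using ⟨hS' (e x).2, (e.monotone hx' : e x ≤ i)⟩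
  · calc M + 1 = (Finset.Ici (⟨M, by omega⟩ : Fin (2 * M + 1))).card := by simp; omega
      _ ≤ _ := Finset.card_le_card_of_injOn (fun x => (e x : Fin K)) (fun x hx => ?_)
        (fun x _ y _ hxy => e.injective (Subtype.ext hxy))
    have hx' : (⟨M, by omega⟩ : Fin (2 * M + 1)) ≤ x := by simpa using hx
    simpa using ⟨hS' (e x).2, (e.monotone hx' : i ≤ e x)⟩

/-! ### Activity of receivers under a zero-forcing code -/

theorem mutualInfo_eq_zero_iff {Ω α β : Type*} [MeasurableSpace Ω] [MeasurableSpace α]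
    [MeasurableSpace β] {X : Ω → α} {Y : Ω → β} {ρ : Measure Ω} [IsProbabilityMeasure ρ]
    (hX : Measurable X) (hY : Measurable Y) : mutualInfo X Y ρ = 0 ↔ IndepFun X Y ρ := by
  have := Measure.isProbabilityMeasure_map (μ := ρ) hX.aemeasurable
  have := Measure.isProbabilityMeasure_map (μ := ρ) hY.aemeasurable
  have := Measure.isProbabilityMeasure_map (μ := ρ) (hX.prodMk hY).aemeasurable
  rw [mutualInfo, InformationTheory.klDiv_eq_zero_iff,
    indepFun_iff_map_prod_eq_prod_map_map hX.aemeasurable hY.aemeasurable]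

namespace Code

variable {K n : ℕ} (c : Code K n)

instance (i : Fin K) : Nonempty (Fin (c.card i)) := Fin.pos_iff_nonempty.1 (c.card_pos i)

instance : IsProbabilityMeasure c.msgLaw := by
  unfold msgLaw; infer_instance

theorem measurable_msg {α : Type*} [MeasurableSpace α] (f : c.Msg → α) : Measurable f :=
  measurable_of_finite f

theorem msgLaw_map_eval (j : Fin K) :
    c.msgLaw.map (fun w => w j) = uniformOn (Set.univ : Set (Fin (c.card j))) :=
  (measurePreserving_eval (fun i => uniformOn (Set.univ : Set (Fin (c.card i)))) j).map_eq

theorem msgLaw_preimage (j : Fin K) (s : Finset (Fin (c.card j))) :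
    c.msgLaw {w | w j ∈ s} = s.card / c.card j := by
  have h := congrArg (fun ν => ν (s : Set (Fin (c.card j)))) (c.msgLaw_map_eval j)
  simp only [Measure.map_apply (c.measurable_msg fun w => w j) s.measurableSet] at h
  rw [uniformOn_univ] at h
  simpa [Set.preimage, Measure.count_apply_finset] using h

variable {c} {T : Fin K → Finset (Fin K)} {G : Fin K → Fin K → ℂ}

theorem not_active_iff {j : Fin K} :
    ¬ c.Active T G j ↔ IndepFun (c.noiseless T G j) (fun w => w j) c.msgLaw := by
  rw [Active, not_lt, nonpos_iff_eq_zero,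
    mutualInfo_eq_zero_iff (c.measurable_msg _) (c.measurable_msg _)]

theorem not_activeAt_iff {j : Fin K} {t : Fin n} :
    ¬ c.ActiveAt T G t j ↔
      IndepFun (fun w => c.noiseless T G j w t) (fun w => w j) c.msgLaw := by
  rw [ActiveAt, not_lt, nonpos_iff_eq_zero,
    mutualInfo_eq_zero_iff (c.measurable_msg _) (c.measurable_msg _)]

theorem ActiveAt.active {j : Fin K} {t : Fin n} (h : c.ActiveAt T G t j) : c.Active T G j := by
  by_contra hn
  rw [not_active_iff] at hn
  exact not_activeAt_iff.2 (hn.comp (measurable_pi_apply t) measurable_id) h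

theorem IsZeroForcing.determined (hc : c.IsZeroForcing T G) {j : Fin K} (h : c.Active T G j) :
    ∃ f : Fin (c.card j) → Fin n → ℂ, ∀ w, c.noiseless T G j w = f (w j) :=
  (hc j).resolve_left h.ne'

/-- When `W_j` determines the noiseless signal, receiver `j` is active in channel use `t` exactly
if the signal in channel use `t` is not constant. -/
theorem activeAt_iff_of_determined {j : Fin K} {t : Fin n} {f : Fin (c.card j) → Fin n → ℂ}
    (hf : ∀ w, c.noiseless T G j w = f (w j)) :
    c.ActiveAt T G t j ↔ ∃ w w', f w t ≠ f w' t := by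
  rw [← not_iff_not, not_activeAt_iff]
  push Not
  simp only [hf]
  constructor
  · intro h w w'
    have hmul := h.measure_inter_preimage_eq_mul {f w' t} {w} (measurableSet_singleton _)
      (measurableSet_singleton _)
    by_contra hne
    have hempty :
        (fun m : c.Msg => f (m j) t) ⁻¹' {f w' t} ∩ (fun m : c.Msg => m j) ⁻¹' {w} = ∅ := by
      ext m
      simp only [Set.mem_inter_iff, Set.mem_preimage, Set.mem_singleton_iff,
        Set.mem_empty_iff_false, iff_false, not_and]
      rintro h1 rfl
      exact hne h1
    have hpos : ∀ v, c.msgLaw ((fun m : c.Msg => m j) ⁻¹' {v}) ≠ 0 := by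
      intro v
      have := c.msgLaw_preimage j {v}
      simp only [Finset.mem_singleton] at this
      change c.msgLaw {m | m j = v} ≠ 0
      rw [this]
      simp
    rw [hempty, measure_empty, eq_comm, mul_eq_zero] at hmul
    refine hmul.elim (fun h0 => hpos w' (measure_mono_null ?_ h0)) (hpos w)
    rintro m rfl
    rfl
  · intro h
    obtain ⟨v⟩ : Nonempty (Fin (c.card j)) := inferInstance
    have : (fun m : c.Msg => f (m j) t) = fun _ => f v t := funext fun m => h _ _
    rw [this]
    exact indepFun_const_left _ _

/-- Changing the message `W_i` alone changes the received signals by the effect of a beam supported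
on `T i`. -/
theorem noiseless_update_sub (c : Code K n) (T : Fin K → Finset (Fin K)) (G : Fin K → Fin K → ℂ)
    (j i : Fin K) (m : c.Msg) (w w' : Fin (c.card i)) (t : Fin n) :
    c.noiseless T G j (Function.update m i w) t - c.noiseless T G j (Function.update m i w') t =
      ∑ k, G j k * (if k ∈ T i then c.beam k i w t - c.beam k i w' t else 0) := by
  simp only [noiseless, tx, ← Finset.sum_sub_distrib, ← mul_sub, Finset.sum_filter]
  refine Finset.sum_congr rfl fun k _ => ?_
  congr 1
  rw [Finset.sum_eq_single i]
  · split_ifs <;> simp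
  · intro i' _ hi'
    simp [Function.update_of_ne hi']
  · simp

theorem card_activeAt_window_le {a b M : ℕ} {H : Fin K → Fin K → ℂ}
    (hH : AlgebraicIndependent ℚ (fun e : Fin K × Fin K => H e.1 e.2))
    (hT : ∀ i, (T i).card ≤ M) (hc : c.IsZeroForcing T (localChannel a b H)) (t : Fin n) (s : ℕ) :
    {j : Fin K | s ≤ (j : ℕ) ∧ (j : ℕ) < s + (2 * M + (a + b)) ∧
      c.ActiveAt T (localChannel a b H) t j}.ncard ≤ 2 * M := by
  classical
  by_contra! hcon
  set A := {j : Fin K | s ≤ (j : ℕ) ∧ (j : ℕ) < s + (2 * M + (a + b)) ∧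
      c.ActiveAt T (localChannel a b H) t j} with hA
  rw [Set.ncard_eq_toFinset_card'] at hcon
  obtain ⟨i, hi, hlo, hhi⟩ := exists_middle A.toFinset hcon
  have hiA : i ∈ A := by simpa using hi
  obtain ⟨f, hf⟩ := hc.determined hiA.2.2.active
  obtain ⟨w, w', hww⟩ := (activeAt_iff_of_determined hf).1 hiA.2.2
  obtain ⟨m⟩ : Nonempty c.Msg := inferInstance
  refine not_exists_sparse_zeroForcing (a := a) (b := b) hH (S := A.toFinset) (s := s)
    (fun j hj => ?_) hi hlo hhi
    (fun k => if k ∈ T i then c.beam k i w t - c.beam k i w' t else 0) ?_ (fun j hj hji => ?_) ?_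
  · have : j ∈ A := by simpa using hj
    exact ⟨this.1, this.2.1⟩
  · refine (Finset.card_le_card fun k hk => ?_).trans (hT i)
    by_contra hk'
    simp [hk'] at hk
  · have hjA : j ∈ A := by simpa using hj
    obtain ⟨g, hg⟩ := hc.determined hjA.2.2.active
    rw [← c.noiseless_update_sub T _ j i m w w' t, hg, hg, Function.update_of_ne hji,
      Function.update_of_ne hji, sub_self]
  · rw [← c.noiseless_update_sub T _ i i m w w' t, hf, hf, Function.update_self,
      Function.update_self]
    exact sub_ne_zero.2 hww

end Code

/-! ### Gaussian noise: change of measure -/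

theorem measurable_complex_mk : Measurable fun p : ℝ × ℝ => (⟨p.1, p.2⟩ : ℂ) :=
  Complex.measurableEquivRealProd.symm.measurable

instance : IsProbabilityMeasure complexGaussian :=
  Measure.isProbabilityMeasure_map measurable_complex_mk.aemeasurable

/-- Comparison of densities, by completing the square in the exponent. -/
theorem gaussianReal_le_smul {P : ℝ} (hP : 0 < P) (m : ℝ) :
    gaussianReal m (1 / 2 : ℝ≥0) ≤
      ENNReal.ofReal (√(1 + P) * Real.exp (m ^ 2 / P)) •
        gaussianReal 0 (Real.toNNReal ((1 + P) / 2)) := by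
  have hv : Real.toNNReal ((1 + P) / 2) ≠ 0 := by
    rw [Ne, Real.toNNReal_eq_zero, not_le]; positivity
  rw [gaussianReal_of_var_ne_zero _ (by norm_num), gaussianReal_of_var_ne_zero _ hv,
    ← withDensity_smul _ (measurable_gaussianPDF _ _)]
  refine withDensity_mono (ae_of_all _ fun x => ?_)
  simp only [gaussianPDF, Pi.smul_apply, smul_eq_mul]
  rw [← ENNReal.ofReal_mul (by positivity)]
  refine ENNReal.ofReal_le_ofReal ?_
  simp only [gaussianPDFReal, Real.coe_toNNReal _ (show 0 ≤ (1 + P) / 2 by positivity)]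
  have h1 : (√(2 * Real.pi * ((1 / 2 : ℝ≥0) : ℝ)))⁻¹ = (√Real.pi)⁻¹ := by
    congr 2; push_cast; ring
  have h2 : (√(2 * Real.pi * ((1 + P) / 2)))⁻¹ = (√(1 + P))⁻¹ * (√Real.pi)⁻¹ := by
    rw [← mul_inv, ← Real.sqrt_mul (by positivity)]
    congr 2; ring
  rw [h1, h2]
  have hs : √(1 + P) ≠ 0 := by positivity
  have hexp : Real.exp (-(x - m) ^ 2 / (2 * ((1 / 2 : ℝ≥0) : ℝ))) ≤
      Real.exp (m ^ 2 / P) * Real.exp (-(x - 0) ^ 2 / (2 * ((1 + P) / 2))) := by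
    rw [← Real.exp_add]
    refine Real.exp_le_exp.2 ?_
    have hP1 : (0 : ℝ) < 1 + P := by positivity
    have : m ^ 2 / P + -(x - 0) ^ 2 / (2 * ((1 + P) / 2)) -
        -(x - m) ^ 2 / (2 * ((1 / 2 : ℝ≥0) : ℝ)) = ((1 + P) * m - P * x) ^ 2 / (P * (1 + P)) := by
      push_cast
      field_simp
      ring
    have h3 : 0 ≤ ((1 + P) * m - P * x) ^ 2 / (P * (1 + P)) := by positivity
    linarith
  calc (√Real.pi)⁻¹ * Real.exp (-(x - m) ^ 2 / (2 * ((1 / 2 : ℝ≥0) : ℝ)))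
      ≤ (√Real.pi)⁻¹ * (Real.exp (m ^ 2 / P) *
          Real.exp (-(x - 0) ^ 2 / (2 * ((1 + P) / 2)))) := by gcongr
    _ = _ := by field_simp

theorem prod_le_smul_prod {α β : Type*} [MeasurableSpace α] [MeasurableSpace β]
    {μ μ' : Measure α} {ν ν' : Measure β} [SFinite ν] [SFinite ν'] {c d : ℝ≥0∞}
    (h : μ ≤ c • μ') (h' : ν ≤ d • ν') : μ.prod ν ≤ (c * d) • μ'.prod ν' := by
  refine Measure.le_iff.2 fun s hs => ?_
  rw [Measure.smul_apply, Measure.prod_apply hs, Measure.prod_apply hs, smul_eq_mul]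
  calc ∫⁻ x, ν (Prod.mk x ⁻¹' s) ∂μ ≤ ∫⁻ x, d * ν' (Prod.mk x ⁻¹' s) ∂(c • μ') :=
        lintegral_mono' h fun x => h' _
    _ = _ := by
      rw [lintegral_smul_measure, lintegral_const_mul _ (measurable_measure_prodMk_left hs),
        smul_eq_mul, mul_assoc]

theorem pi_le_smul_pi {ι : Type*} [Fintype ι] {α : ι → Type*} [∀ i, MeasurableSpace (α i)]
    {μ ν : ∀ i, Measure (α i)} [∀ i, SigmaFinite (μ i)] [∀ i, SigmaFinite (ν i)] {c : ι → ℝ≥0}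
    (h : ∀ i, μ i ≤ c i • ν i) : Measure.pi μ ≤ (∏ i, c i) • Measure.pi ν := by
  have hsmul : Measure.pi (fun i => c i • ν i) = (∏ i, c i) • Measure.pi ν := by
    refine Measure.pi_eq fun s _ => ?_
    simp only [Measure.smul_apply, Measure.pi_pi, Finset.prod_smul]
  rw [← hsmul]
  refine Measure.le_iff.2 fun s _ => ?_
  have h1 : (Measure.pi μ).toOuterMeasure ≤
      OuterMeasure.pi fun i => (c i • ν i).toOuterMeasure := by
    refine OuterMeasure.le_pi.2 fun t _ => ?_
    change Measure.pi μ _ ≤ _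
    rw [Measure.pi_pi]
    exact Finset.prod_le_prod' fun i _ => h i _
  refine (h1 s).trans ?_
  rw [Measure.pi_def]
  exact le_toMeasure_apply _ _ _

/-- Every translate of the noise law is dominated by one probability measure, up to a factor that
depends on the size of the translation. -/
theorem exists_dominating_measure {P : ℝ} (hP : 0 < P) :
    ∃ Q : Measure ℂ, IsProbabilityMeasure Q ∧ ∀ x : ℂ, complexGaussian.map (x + ·) ≤
      Real.toNNReal ((1 + P) * Real.exp (‖x‖ ^ 2 / P)) • Q := by
  let v := Real.toNNReal ((1 + P) / 2)
  let mk : ℝ × ℝ → ℂ := fun p => ⟨p.1, p.2⟩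
  have hmk : Measurable mk := measurable_complex_mk
  refine ⟨((gaussianReal 0 v).prod (gaussianReal 0 v)).map mk,
    Measure.isProbabilityMeasure_map hmk.aemeasurable, fun x => ?_⟩
  have h1 : complexGaussian.map (x + ·) =
      ((gaussianReal x.re (1 / 2 : ℝ≥0)).prod (gaussianReal x.im (1 / 2 : ℝ≥0))).map mk := by
    have hre := gaussianReal_map_const_add (μ := 0) (v := (1 / 2 : ℝ≥0)) x.re
    have him := gaussianReal_map_const_add (μ := 0) (v := (1 / 2 : ℝ≥0)) x.im
    rw [zero_add] at hre him
    rw [← hre, ← him, Measure.map_prod_map _ _ (by fun_prop) (by fun_prop),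
      Measure.map_map hmk (by fun_prop), complexGaussian,
      Measure.map_map (by fun_prop) hmk]
    congr 1
  rw [h1]
  have h2 := prod_le_smul_prod (gaussianReal_le_smul hP x.re) (gaussianReal_le_smul hP x.im)
  have h3 := Measure.map_mono h2 hmk
  rw [Measure.map_smul] at h3
  refine h3.trans (le_of_eq ?_)
  rw [← ENNReal.ofReal_mul (by positivity), ENNReal.smul_def, ENNReal.ofReal]
  congr 3
  have : ‖x‖ ^ 2 = x.re ^ 2 + x.im ^ 2 := by rw [Complex.sq_norm, Complex.normSq_apply]; ring
  rw [this, add_div, Real.exp_add]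
  have hs : √(1 + P) * √(1 + P) = 1 + P := Real.mul_self_sqrt (by positivity)
  linear_combination (Real.exp (x.re ^ 2 / P) * Real.exp (x.im ^ 2 / P)) * hs

/-- The law of a block of `n` noise samples. -/
noncomputable abbrev noiseLaw (n : ℕ) : Measure (Fin n → ℂ) :=
  Measure.pi fun _ : Fin n => complexGaussian

/-- Counting form of the channel converse: the probabilities of correct decoding of codewords of
energy at most `B` add up to at most `(1 + P) ^ m * exp (B / P)`, where `m` is the number of
coordinates in which the codewords are not all equal. All output laws are dominated by a multiple
of one probability measure, which gives the disjoint decoding regions total mass at most one. -/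
theorem sum_correct_le {ι : Type*} {n : ℕ} {P B : ℝ} (hP : 0 < P)
    (x : ι → Fin n → ℂ) (D : ι → Set (Fin n → ℂ)) (hD : ∀ w, MeasurableSet (D w))
    (hdisj : Pairwise (Function.onFun Disjoint D)) (A : Finset (Fin n))
    (hA : ∀ t ∉ A, ∀ w w', x w t = x w' t) (s : Finset ι)
    (hs : ∀ w ∈ s, ∑ t, ‖x w t‖ ^ 2 ≤ B) :
    ∑ w ∈ s, noiseLaw n {z | x w + z ∈ D w} ≤
      ENNReal.ofReal ((1 + P) ^ A.card * Real.exp (B / P)) := by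
  classical
  rcases s.eq_empty_or_nonempty with rfl | ⟨w₀, -⟩
  · simp
  obtain ⟨Q, hQ, hdom⟩ := exists_dominating_measure hP
  have hprob : ∀ y : ℂ, IsProbabilityMeasure (complexGaussian.map (y + ·)) := fun y =>
    Measure.isProbabilityMeasure_map (by fun_prop)
  let ν : Fin n → Measure ℂ := fun t => if t ∈ A then Q else complexGaussian.map (x w₀ t + ·)
  have hν : ∀ t, IsProbabilityMeasure (ν t) := fun t => by
    simp only [ν]; split_ifs <;> infer_instance
  have hle : ∀ w ∈ s, noiseLaw n {z | x w + z ∈ D w} ≤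
      ENNReal.ofReal ((1 + P) ^ A.card * Real.exp (B / P)) * Measure.pi ν (D w) := by
    intro w hw
    let c : Fin n → ℝ≥0 := fun t =>
      if t ∈ A then Real.toNNReal ((1 + P) * Real.exp (‖x w t‖ ^ 2 / P)) else 1
    have h1 : ∀ t, complexGaussian.map (x w t + ·) ≤ c t • ν t := by
      intro t
      simp only [c, ν]
      split_ifs with ht
      · exact hdom _
      · rw [one_smul, hA t ht w w₀]
    have h2 := pi_le_smul_pi h1 (D w)
    have h3 : Measure.pi (fun t => complexGaussian.map (x w t + ·)) (D w) =
        noiseLaw n {z | x w + z ∈ D w} := by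
      rw [← Measure.pi_map_pi (fun t => by fun_prop), Measure.map_apply (by fun_prop) (hD w)]
      rfl
    rw [h3, Measure.smul_apply, ENNReal.smul_def, smul_eq_mul] at h2
    refine h2.trans (mul_le_mul_left ?_ _)
    rw [ENNReal.ofReal, ENNReal.coe_le_coe]
    simp only [c]
    rw [Finset.prod_ite_mem, Finset.univ_inter,
      ← Real.toNNReal_prod_of_nonneg (fun t _ => by positivity)]
    refine Real.toNNReal_le_toNNReal ?_
    rw [Finset.prod_mul_distrib, Finset.prod_const, ← Real.exp_sum, ← Finset.sum_div]
    have h4 : ∑ t ∈ A, ‖x w t‖ ^ 2 ≤ B :=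
      (Finset.sum_le_sum_of_subset_of_nonneg (Finset.subset_univ A)
        fun t _ _ => by positivity).trans (hs w hw)
    gcongr
  refine (Finset.sum_le_sum hle).trans ?_
  rw [← Finset.mul_sum, ← measure_biUnion_finset (fun i _ j _ hij => hdisj hij) fun w _ => hD w]
  exact (mul_le_mul_right prob_le_one _).trans (mul_one _).le

/-! ### Bounds on the number of messages of a user -/

namespace Code

variable {K n : ℕ} {c : Code K n} {T : Fin K → Finset (Fin K)} {G : Fin K → Fin K → ℂ}

theorem lintegral_msg (c : Code K n) (j : Fin K) (q : Fin (c.card j) → ℝ≥0∞) :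
    ∫⁻ m, q (m j) ∂c.msgLaw = (∑ v, q v) / c.card j := by
  rw [← lintegral_map (μ := c.msgLaw) (f := q) (g := fun m => m j) (measurable_of_finite q)
    (c.measurable_msg _), c.msgLaw_map_eval, lintegral_fintype, div_eq_mul_inv, Finset.sum_mul]
  refine Finset.sum_congr rfl fun v _ => ?_
  congr 1
  rw [uniformOn_univ]
  simp

theorem measurableSet_correct (j : Fin K) :
    MeasurableSet {p : c.Msg × (Fin n → ℂ) | c.dec j (c.noiseless T G j p.1 + p.2) = p.1 j} := by
  have h1 : Measurable fun p : c.Msg × (Fin n → ℂ) => c.dec j (c.noiseless T G j p.1 + p.2) :=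
    (c.measurable_dec j).comp
      (((c.measurable_msg (c.noiseless T G j)).comp measurable_fst).add measurable_snd)
  have h2 : Measurable fun p : c.Msg × (Fin n → ℂ) => p.1 j :=
    (c.measurable_msg fun m => m j).comp measurable_fst
  exact (h1.prodMk h2) (Set.toFinite {q | q.1 = q.2}).measurableSet

theorem one_le_errorProb_add (j : Fin K) :
    1 ≤ c.errorProb T G j +
      ∫⁻ m, noiseLaw n {z | c.dec j (c.noiseless T G j m + z) = m j} ∂c.msgLaw := by
  have h := prob_add_prob_compl (μ := c.msgLaw.prod (noiseLaw n))
    (c.measurableSet_correct (T := T) (G := G) j)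
  rw [Measure.prod_apply (c.measurableSet_correct j), add_comm] at h
  exact h.symm.le

/-- A user whose received signal carries no information on its message has few messages: its
receiver decodes correctly with probability `1 / card`. -/
theorem card_le_of_not_active {j : Fin K} (hj : ¬ c.Active T G j)
    (he : c.errorProb T G j ≤ 1 / 4) : (c.card j : ℝ) ≤ 2 := by
  rw [not_active_iff] at hj
  let h : Fin (c.card j) → (Fin n → ℂ) → ℝ≥0∞ := fun v y => noiseLaw n {z | c.dec j (y + z) = v}
  have hmeas : ∀ v, MeasurableSet {p : (Fin n → ℂ) × (Fin n → ℂ) | c.dec j (p.1 + p.2) = v} :=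
    fun v => ((c.measurable_dec j).comp (measurable_fst.add measurable_snd))
      (measurableSet_singleton v)
  have hh : ∀ v, Measurable (h v) := fun v => measurable_measure_prodMk_left (hmeas v)
  have hsum : ∀ y, ∑ v, h v y = 1 := by
    intro y
    have hm : Measurable fun z : Fin n → ℂ => c.dec j (y + z) :=
      (c.measurable_dec j).comp (measurable_const.add measurable_id)
    simp only [h]
    have := sum_measure_preimage_singleton (μ := noiseLaw n) (f := fun z => c.dec j (y + z))
      Finset.univ (fun v _ => hm (measurableSet_singleton v))
    simpa [Set.preimage] using this
  have hcorrect : ∫⁻ m, noiseLaw n {z | c.dec j (c.noiseless T G j m + z) = m j} ∂c.msgLaw =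
      (c.card j : ℝ≥0∞)⁻¹ := by
    let e : Fin (c.card j) → Fin (c.card j) → ℝ≥0∞ := fun v w => if w = v then 1 else 0
    calc ∫⁻ m, noiseLaw n {z | c.dec j (c.noiseless T G j m + z) = m j} ∂c.msgLaw
        = ∫⁻ m, ∑ v, h v (c.noiseless T G j m) * e v (m j) ∂c.msgLaw := by
          refine lintegral_congr fun m => ?_
          simp [e, h]
      _ = ∑ v, ∫⁻ m, h v (c.noiseless T G j m) * e v (m j) ∂c.msgLaw :=
          lintegral_finsetSum _ fun v _ => c.measurable_msg _
      _ = ∑ v, (∫⁻ m, h v (c.noiseless T G j m) ∂c.msgLaw) * (c.card j : ℝ≥0∞)⁻¹ := by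
          refine Finset.sum_congr rfl fun v _ => ?_
          have hind : IndepFun (fun m => h v (c.noiseless T G j m)) (fun m => e v (m j)) c.msgLaw :=
            hj.comp (hh v) (measurable_of_finite (e v))
          have := lintegral_mul_eq_lintegral_mul_lintegral_of_indepFun''
            (c.measurable_msg _).aemeasurable
            (c.measurable_msg _).aemeasurable hind
          rw [this, c.lintegral_msg j (e v)]
          simp [e]
      _ = (∫⁻ m, ∑ v, h v (c.noiseless T G j m) ∂c.msgLaw) * (c.card j : ℝ≥0∞)⁻¹ := by
          rw [← Finset.sum_mul, lintegral_finsetSum _ fun v _ => c.measurable_msg _]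
      _ = _ := by simp [hsum]
  have h1 := c.one_le_errorProb_add (T := T) (G := G) j
  rw [hcorrect] at h1
  by_contra! hgt
  have h3 : (3 : ℝ≥0∞) ≤ c.card j := by
    have : 2 < c.card j := by exact_mod_cast hgt
    exact_mod_cast this
  have h4 : (1 : ℝ≥0∞) ≤ 1 / 4 + 3⁻¹ :=
    h1.trans (add_le_add he (ENNReal.inv_le_inv.2 h3))
  have h5 := ENNReal.toReal_mono (by simp) h4
  rw [ENNReal.toReal_add (by simp) (by simp)] at h5
  norm_num at h5

/-- The power constraint bounds the expected energy of the received signal. -/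
theorem integral_noiseless_le {P : ℝ} (hpow : c.PowerConstraint T P) (j : Fin K) :
    ∫ m, ∑ t, ‖c.noiseless T G j m t‖ ^ 2 ∂c.msgLaw ≤
      n * ((∑ k, ‖G j k‖ ^ 2) * K) * P := by
  have hint : ∀ f : c.Msg → ℝ, Integrable f c.msgLaw := fun f => Integrable.of_finite
  have hpt : ∀ m, ∑ t, ‖c.noiseless T G j m t‖ ^ 2 ≤
      (∑ k, ‖G j k‖ ^ 2) * ∑ k, ∑ t, ‖c.tx T m k t‖ ^ 2 := by
    intro m
    rw [Finset.sum_comm, Finset.mul_sum]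
    refine Finset.sum_le_sum fun t _ => ?_
    calc ‖c.noiseless T G j m t‖ ^ 2 ≤ (∑ k, ‖G j k‖ * ‖c.tx T m k t‖) ^ 2 := by
          gcongr
          exact (norm_sum_le _ _).trans (Finset.sum_le_sum fun k _ => norm_mul_le _ _)
      _ ≤ _ := Finset.sum_mul_sq_le_sq_mul_sq _ _ _
  calc ∫ m, ∑ t, ‖c.noiseless T G j m t‖ ^ 2 ∂c.msgLaw
      ≤ ∫ m, (∑ k, ‖G j k‖ ^ 2) * ∑ k, ∑ t, ‖c.tx T m k t‖ ^ 2 ∂c.msgLaw :=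
        integral_mono (hint _) (hint _) hpt
    _ = (∑ k, ‖G j k‖ ^ 2) * ∑ k, ∫ m, ∑ t, ‖c.tx T m k t‖ ^ 2 ∂c.msgLaw := by
        rw [integral_const_mul, integral_finsetSum _ fun k _ => hint _]
    _ ≤ (∑ k, ‖G j k‖ ^ 2) * ∑ k : Fin K, (n * P : ℝ) := by
        gcongr with k
        exact hpow k
    _ = _ := by simp; ring

open Classical in
/-- A user whose message determines its received signal has at most about `(1 + P) ^ m` messages,
where `m` is the number of channel uses in which its receiver is active. -/
theorem card_le_of_determined {P C : ℝ} (hP : 0 < P) (hC : 0 < C) (hn : 0 < n) {j : Fin K}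
    {f : Fin (c.card j) → Fin n → ℂ} (hf : ∀ w, c.noiseless T G j w = f (w j))
    (hen : ∫ m, ∑ t, ‖c.noiseless T G j m t‖ ^ 2 ∂c.msgLaw ≤ n * C * P)
    (he : c.errorProb T G j ≤ 1 / 4) :
    (c.card j : ℝ) ≤ 2 * ((1 + P) ^ (Finset.univ.filter fun t => c.ActiveAt T G t j).card *
      Real.exp (4 * n * C)) := by
  set A := Finset.univ.filter fun t => c.ActiveAt T G t j with hA
  have hN : (0 : ℝ) < c.card j := by exact_mod_cast c.card_pos j
  have hn' : (0 : ℝ) < n := by exact_mod_cast hn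
  let q : Fin (c.card j) → ℝ≥0∞ := fun v => noiseLaw n {z | c.dec j (f v + z) = v}
  let s : Finset (Fin (c.card j)) :=
    Finset.univ.filter fun v => ∑ t, ‖f v t‖ ^ 2 < 4 * n * C * P
  -- by Markov's inequality at most a quarter of the codewords have large energy
  have hbad : (sᶜ.card : ℝ) ≤ c.card j / 4 := by
    have hmarkov := mul_meas_ge_le_integral_of_nonneg (μ := c.msgLaw)
      (f := fun m => ∑ t, ‖f (m j) t‖ ^ 2) (ae_of_all _ fun m => by positivity)
      Integrable.of_finite (4 * n * C * P)
    have hset : {m : c.Msg | 4 * n * C * P ≤ ∑ t, ‖f (m j) t‖ ^ 2} = {m | m j ∈ sᶜ} := by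
      ext m
      simp [s]
    rw [hset, Measure.real, c.msgLaw_preimage] at hmarkov
    simp only [hf] at hen
    have h1 := hmarkov.trans hen
    rw [ENNReal.toReal_div, ENNReal.toReal_natCast, ENNReal.toReal_natCast] at h1
    have h2 : (0 : ℝ) < n * C * P := by positivity
    have h3 : (n * C * P) * (4 * ((sᶜ.card : ℝ) / c.card j)) ≤ (n * C * P) * 1 := by linarith
    have h4 := le_of_mul_le_mul_left h3 h2
    rw [mul_div_assoc', div_le_one hN] at h4
    linarith
  have hcorrect : ∑ v ∈ s, q v ≤ ENNReal.ofReal ((1 + P) ^ A.card * Real.exp (4 * n * C)) := by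
    have := sum_correct_le hP f (fun v => {y | c.dec j y = v})
      (fun v => c.measurable_dec j (measurableSet_singleton v))
      (fun v w hvw => Set.disjoint_left.2 fun y hy hy' => hvw (hy.symm.trans hy')) A
      (fun t ht w w' => by
        by_contra hne
        exact ht (Finset.mem_filter.2 ⟨Finset.mem_univ _,
          (activeAt_iff_of_determined hf).2 ⟨w, w', hne⟩⟩)) s
      (fun w hw => (Finset.mem_filter.1 hw).2.le)
    rwa [mul_div_assoc, div_self hP.ne', mul_one] at this
  have hbadq : ∑ v ∈ sᶜ, q v ≤ sᶜ.card := by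
    calc ∑ v ∈ sᶜ, q v ≤ ∑ v ∈ sᶜ, 1 := Finset.sum_le_sum fun v _ => prob_le_one
      _ = _ := by simp
  have h1 := c.one_le_errorProb_add (T := T) (G := G) j
  simp only [hf] at h1
  rw [c.lintegral_msg j q, ← Finset.sum_add_sum_compl s] at h1
  have h2 : (1 : ℝ≥0∞) ≤ 1 / 4 + (ENNReal.ofReal ((1 + P) ^ A.card * Real.exp (4 * n * C)) +
      sᶜ.card) / c.card j :=
    h1.trans (add_le_add he (ENNReal.div_le_div_right (add_le_add hcorrect hbadq) _))
  have hfin : (ENNReal.ofReal ((1 + P) ^ A.card * Real.exp (4 * n * C)) +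
      sᶜ.card) / c.card j ≠ ∞ :=
    ENNReal.div_ne_top (by simp) (by simpa using (c.card_pos j).ne')
  have h3 := ENNReal.toReal_mono (ENNReal.add_ne_top.2 ⟨by simp, hfin⟩) h2
  rw [ENNReal.toReal_add (by simp) hfin, ENNReal.toReal_div (_ + _),
    ENNReal.toReal_add (by simp) (by simp),
    ENNReal.toReal_ofReal (by positivity), ENNReal.toReal_natCast, ENNReal.toReal_natCast] at h3
  have h4 : (1 : ℝ) ≤ 1 / 4 + ((1 + P) ^ A.card * Real.exp (4 * n * C) + sᶜ.card) / c.card j := by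
    simpa using h3
  have h5 : (3 / 4 : ℝ) ≤ ((1 + P) ^ A.card * Real.exp (4 * n * C) + sᶜ.card) / c.card j := by
    linarith
  rw [le_div_iff₀ hN] at h5
  linarith

open Classical in
/-- Single-user converse for zero-forcing codes. -/
theorem IsZeroForcing.card_le {P C : ℝ} (hc : c.IsZeroForcing T G) (hP : 0 < P)
    (hpow : c.PowerConstraint T P) (hn : 0 < n) {j : Fin K} (hC : (∑ k, ‖G j k‖ ^ 2) * K < C)
    (he : c.errorProb T G j ≤ 1 / 4) :
    (c.card j : ℝ) ≤ 2 * ((1 + P) ^ (Finset.univ.filter fun t => c.ActiveAt T G t j).card *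
      Real.exp (4 * n * C)) := by
  have hC0 : 0 < C := lt_of_le_of_lt (by positivity) hC
  by_cases hact : c.Active T G j
  · obtain ⟨f, hf⟩ := hc.determined hact
    refine card_le_of_determined hP hC0 hn hf ((integral_noiseless_le hpow j).trans ?_) he
    gcongr
  · refine (card_le_of_not_active hact he).trans ?_
    have h1 : (1 : ℝ) ≤ (1 + P) ^ (Finset.univ.filter fun t => c.ActiveAt T G t j).card :=
      one_le_pow₀ (by linarith)
    have h2 : (1 : ℝ) ≤ Real.exp (4 * n * C) := Real.one_le_exp (by positivity)
    nlinarith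

end Code

/-! ### The converse -/

/-- The users `s, …, s + N - 1`, as far as they exist. -/
def window (K s N : ℕ) : Finset (Fin K) :=
  Finset.univ.filter fun j => s ≤ (j : ℕ) ∧ (j : ℕ) < s + N

/-- Summing the single-user converses over a window: in each channel use at most `2 * M` of its
users are active. -/
theorem sum_rate_window_le {a b M K : ℕ} {H : Fin K → Fin K → ℂ}
    (hH : AlgebraicIndependent ℚ (fun e : Fin K × Fin K => H e.1 e.2))
    {T : Fin K → Finset (Fin K)} (hT : ∀ i, (T i).card ≤ M) {A : Set (Fin K)} {P : ℝ} (hP : 1 ≤ P)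
    {R : Fin K → ℝ} (hR : ZFRatesAchievable T (localChannel a b H) A P R) {C : ℝ}
    (hC : ∀ j, (∑ k, ‖localChannel a b H j k‖ ^ 2) * K < C) (s : ℕ) :
    ∑ j ∈ window K s (2 * M + (a + b)), R j ≤
      (window K s (2 * M + (a + b))).card * (Real.log 2 + 4 * C) +
        2 * M * (Real.log 2 + Real.log P) := by
  classical
  set W := window K s (2 * M + (a + b)) with hW
  set G := localChannel a b H
  have hP0 : 0 < P := by linarith
  obtain ⟨N, hN⟩ := hR (1 / 4) (by simp)
  obtain ⟨n, hNn, hn⟩ : ∃ n, N ≤ n ∧ 0 < n := ⟨N + 1, Nat.le_succ N, Nat.succ_pos N⟩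
  obtain ⟨c, hcard, hpow, hzf, -, herr⟩ := hN n hNn
  have hn0 : (0 : ℝ) < n := by exact_mod_cast hn
  have hn1 : (1 : ℝ) ≤ n := by exact_mod_cast hn
  have hlog2 : 0 ≤ Real.log 2 := Real.log_nonneg (by norm_num)
  let m : Fin K → ℕ := fun j => (Finset.univ.filter fun t => c.ActiveAt T G t j).card
  have huser : ∀ j, n * R j ≤ n * (Real.log 2 + 4 * C) + m j * Real.log (1 + P) := by
    intro j
    have h1 := (hcard j).trans (hzf.card_le hP0 hpow hn (hC j) (herr j))
    have h2 := Real.log_le_log (Real.exp_pos _) h1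
    rw [Real.log_exp, Real.log_mul (by norm_num) (by positivity),
      Real.log_mul (by positivity) (by positivity), Real.log_pow, Real.log_exp] at h2
    have h3 : Real.log 2 ≤ n * Real.log 2 := le_mul_of_one_le_left hlog2 hn1
    calc n * R j ≤ _ := h2
      _ ≤ _ := by
        simp only [m]
        linarith
  have hm : ∑ j ∈ W, m j ≤ n * (2 * M) := by
    have h1 : ∑ j ∈ W, m j = ∑ t : Fin n, (W.filter fun j => c.ActiveAt T G t j).card := by
      simp only [m, Finset.card_eq_sum_ones, Finset.sum_filter]
      rw [Finset.sum_comm]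
    rw [h1]
    calc _ ≤ ∑ _t : Fin n, 2 * M := Finset.sum_le_sum fun t _ => by
            have := Code.card_activeAt_window_le hH hT hzf t s
            rw [← Set.ncard_coe_finset]
            refine le_trans (le_of_eq (congrArg Set.ncard (Set.ext fun j => ?_))) this
            simp [hW, window, and_assoc, G]
      _ = _ := by simp
  have hlogP : 0 ≤ Real.log (1 + P) := Real.log_nonneg (by linarith)
  have hlog : Real.log (1 + P) ≤ Real.log 2 + Real.log P := by
    rw [← Real.log_mul (by norm_num) hP0.ne']
    exact Real.log_le_log (by linarith) (by linarith)
  have htot : n * ∑ j ∈ W, R j ≤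
      n * (W.card * (Real.log 2 + 4 * C) + 2 * M * (Real.log 2 + Real.log P)) := by
    calc n * ∑ j ∈ W, R j = ∑ j ∈ W, n * R j := Finset.mul_sum _ _ _
      _ ≤ ∑ j ∈ W, (n * (Real.log 2 + 4 * C) + m j * Real.log (1 + P)) :=
          Finset.sum_le_sum fun j _ => huser j
      _ = W.card * (n * (Real.log 2 + 4 * C)) + (∑ j ∈ W, m j : ℕ) * Real.log (1 + P) := by
          rw [Finset.sum_add_distrib, Finset.sum_const, nsmul_eq_mul, ← Finset.sum_mul,
            Nat.cast_sum]
      _ ≤ W.card * (n * (Real.log 2 + 4 * C)) +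
            ((n * (2 * M) : ℕ) : ℝ) * (Real.log 2 + Real.log P) := by
          gcongr
      _ = _ := by push_cast; ring
  exact le_of_mul_le_mul_left htot hn0

theorem sum_dof_window_le {a b M K : ℕ} {μ : Measure ℂ} [IsProbabilityMeasure μ]
    [NullSingletonClass μ] {T : Fin K → Finset (Fin K)} (hT : ∀ i, (T i).card ≤ M)
    {d : Fin K → ℝ} (hd : ZFDoFAchievable a b μ T d) (s : ℕ) :
    ∑ j ∈ window K s (2 * M + (a + b)), d j ≤ 2 * M := by
  have hprob : IsProbabilityMeasure (coeffLaw K μ) := by unfold coeffLaw; infer_instance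
  obtain ⟨H, hH, R, hR, hlim⟩ := ((ae_coeffLaw_algebraicIndependent K μ).and hd.2).exists
  obtain ⟨C, hC⟩ := (Set.finite_range fun j : Fin K =>
    (∑ k, ‖localChannel a b H j k‖ ^ 2) * (K : ℝ)).bddAbove
  have hC' : ∀ j : Fin K, (∑ k, ‖localChannel a b H j k‖ ^ 2) * (K : ℝ) < C + 1 := fun j =>
    (hC ⟨j, rfl⟩).trans_lt (lt_add_one C)
  set W := window K s (2 * M + (a + b))
  have h1 : Tendsto (fun P => ∑ j ∈ W, R P j / Real.log P) atTop (𝓝 (∑ j ∈ W, d j)) :=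
    tendsto_finsetSum _ fun j _ => hlim j
  have h2 : Tendsto (fun P =>
      (W.card * (Real.log 2 + 4 * (C + 1)) + 2 * M * Real.log 2) / Real.log P
      + 2 * M) atTop (𝓝 (0 + 2 * M)) :=
    (Tendsto.div_atTop tendsto_const_nhds Real.tendsto_log_atTop).add tendsto_const_nhds
  rw [zero_add] at h2
  refine le_of_tendsto_of_tendsto h1 h2 ?_
  filter_upwards [eventually_gt_atTop 1] with P hP
  have hlog : 0 < Real.log P := Real.log_pos hP
  have h3 := sum_rate_window_le hH hT hP.le (hR P (by linarith)) hC' s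
  rw [← Finset.sum_div, div_le_iff₀ hlog, add_mul, div_mul_cancel₀ _ hlog.ne']
  calc _ ≤ _ := h3
    _ = _ := by ring

/-- The users are covered by `K / N + 1` windows of length `N = 2 * M + (a + b)`. -/
theorem sum_dof_le {a b M K : ℕ} (hN : 0 < 2 * M + (a + b)) {μ : Measure ℂ}
    [IsProbabilityMeasure μ] [NullSingletonClass μ] {T : Fin K → Finset (Fin K)}
    (hT : ∀ i, (T i).card ≤ M) {d : Fin K → ℝ} (hd : ZFDoFAchievable a b μ T d) :
    ∑ j, d j ≤ 2 * M * ((K / (2 * M + (a + b)) : ℕ) + 1) := by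
  set N := 2 * M + (a + b)
  have h1 : ∑ j, d j = ∑ q ∈ Finset.range (K / N + 1), ∑ j ∈ window K (q * N) N, d j := by
    rw [← Finset.sum_fiberwise_of_maps_to (s := Finset.univ) (t := Finset.range (K / N + 1))
      (g := fun j : Fin K => (j : ℕ) / N)]
    · refine Finset.sum_congr rfl fun q _ => Finset.sum_congr ?_ fun _ _ => rfl
      ext j
      simp only [Finset.mem_filter, Finset.mem_univ, true_and, window]
      rw [Nat.div_eq_iff hN]
      have : q * N + N = N * q + N := by ring
      constructor <;> intro h <;> constructor <;> omega
    · intro j _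
      exact Finset.mem_range.2 (Nat.lt_succ_of_le (Nat.div_le_div_right j.2.le))
  rw [h1]
  calc _ ≤ ∑ q ∈ Finset.range (K / N + 1), (2 * M : ℝ) :=
        Finset.sum_le_sum fun q _ => sum_dof_window_le hT hd _
    _ = _ := by simp; ring

/-! ### Codes for the Gaussian channel -/

theorem volume_energy_le (n : ℕ) (hn : 0 < n) :
    volume {x : Fin n → ℂ | ∑ t, ‖x t‖ ^ 2 ≤ 8 * n} ≤
      ENNReal.ofReal ((8 * Real.pi * Real.exp 1) ^ n) := by
  have : Nonempty (Fin n) := Fin.pos_iff_nonempty.1 hn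
  have hset : {x : Fin n → ℂ | ∑ t, ‖x t‖ ^ 2 ≤ 8 * n} =
      {x : Fin n → ℂ | (∑ t, ‖x t‖ ^ (2 : ℝ)) ^ (1 / (2 : ℝ)) ≤ √(8 * n)} := by
    ext x
    simp only [Set.mem_ofPred_eq, Real.rpow_two, ← Real.sqrt_eq_rpow]
    exact (Real.sqrt_le_sqrt_iff (by positivity)).symm
  rw [hset, Complex.volume_sum_rpow_le _ (by norm_num), ← ENNReal.ofReal_pow (by positivity),
    ← ENNReal.ofReal_mul (by positivity)]
  refine ENNReal.ofReal_le_ofReal ?_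
  rw [Fintype.card_fin, pow_mul, Real.sq_sqrt (by positivity)]
  have h1 : Real.Gamma (2 / 2 + 1) = 1 := by norm_num
  have h2 : Real.Gamma (2 * (n : ℝ) / 2 + 1) = n.factorial := by
    rw [mul_div_cancel_left₀ _ (by norm_num : (2 : ℝ) ≠ 0), Real.Gamma_nat_eq_factorial]
  rw [h1, h2, mul_one]
  have h3 : (n : ℝ) ^ n / n.factorial ≤ Real.exp n :=
    Real.pow_div_factorial_le_exp _ (by positivity) n
  calc (8 * (n : ℝ)) ^ n * (Real.pi ^ n / n.factorial)
      = (8 * Real.pi) ^ n * ((n : ℝ) ^ n / n.factorial) := by rw [mul_pow, mul_pow]; ring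
    _ ≤ (8 * Real.pi) ^ n * Real.exp n := by gcongr
    _ = _ := by rw [mul_pow _ (Real.exp 1), ← Real.exp_nat_mul, mul_one]

/-- Greedy sphere packing in the polydisc of radius `α`: the number of points grows like a constant
times `α ^ 2` per coordinate, and the distances are large compared with the typical noise. -/
theorem exists_codebook (n : ℕ) (hn : 0 < n) {α : ℝ} (hα : 0 < α) :
    ∃ (N : ℕ) (x : Fin N → Fin n → ℂ), 0 < N ∧ (α ^ 2 / (8 * Real.exp 1)) ^ n ≤ N ∧
      (∀ w t, ‖x w t‖ ≤ α) ∧ ∀ w w', w ≠ w' → 8 * n < ∑ t, ‖x w t - x w' t‖ ^ 2 := by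
  set V := (α ^ 2 / (8 * Real.exp 1)) ^ n with hV
  have hV0 : 0 < V := by positivity
  set E := {x : Fin n → ℂ | ∑ t, ‖x t‖ ^ 2 ≤ 8 * n} with hE
  have key : ∀ k ≤ ⌈V⌉₊, ∃ x : Fin k → Fin n → ℂ, (∀ w t, ‖x w t‖ ≤ α) ∧
      ∀ w w', w ≠ w' → 8 * n < ∑ t, ‖x w t - x w' t‖ ^ 2 := by
    intro k
    induction k with
    | zero => exact fun _ => ⟨fun w => w.elim0, fun w => w.elim0, fun w => w.elim0⟩
    | succ k ih =>
      intro hk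
      obtain ⟨x, hx, hsep⟩ := ih (by omega)
      have hkV : (k : ℝ) < V := Nat.lt_ceil.1 hk
      -- the forbidden regions around the points chosen so far do not cover the polydisc
      have hvol : volume (⋃ w : Fin k, (fun y => y + -x w) ⁻¹' E) <
          volume (Metric.closedBall (0 : Fin n → ℂ) α) := by
        calc volume (⋃ w : Fin k, (fun y => y + -x w) ⁻¹' E)
            ≤ ∑ w : Fin k, volume ((fun y => y + -x w) ⁻¹' E) := measure_iUnion_fintype_le _ _
          _ = k * volume E := by simp [measure_preimage_add_right]
          _ ≤ k * ENNReal.ofReal ((8 * Real.pi * Real.exp 1) ^ n) := by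
              gcongr
              exact volume_energy_le n hn
          _ < ENNReal.ofReal ((Real.pi * α ^ 2) ^ n) := by
              rw [← ENNReal.ofReal_natCast, ← ENNReal.ofReal_mul (by positivity)]
              refine (ENNReal.ofReal_lt_ofReal_iff (by positivity)).2 ?_
              have h1 : (Real.pi * α ^ 2) ^ n = V * (8 * Real.pi * Real.exp 1) ^ n := by
                rw [hV, ← mul_pow]
                congr 1
                field_simp
              rw [h1]
              gcongr
          _ = _ := by
              rw [volume_pi_closedBall _ hα.le]
              simp only [Complex.volume_closedBall, Finset.prod_const, Finset.card_univ,
                Fintype.card_fin]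
              rw [ENNReal.ofReal_pow (by positivity), mul_comm Real.pi,
                ENNReal.ofReal_mul (by positivity), ENNReal.ofReal_pow hα.le]
              congr 2
              rw [← NNReal.coe_real_pi, ENNReal.ofReal_coe_nnreal]
      obtain ⟨y, hy, hyn⟩ : ∃ y ∈ Metric.closedBall (0 : Fin n → ℂ) α,
          y ∉ ⋃ w : Fin k, (fun y => y + -x w) ⁻¹' E := by
        by_contra! hcon
        exact hvol.not_ge (measure_mono hcon)
      have hyx : ∀ w, 8 * n < ∑ t, ‖y t - x w t‖ ^ 2 := by
        intro w
        by_contra! hle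
        exact hyn (Set.mem_iUnion.2 ⟨w, by simpa [hE, ← sub_eq_add_neg] using hle⟩)
      refine ⟨Fin.cons y x, fun w => ?_, fun w w' => ?_⟩
      · refine Fin.cases (fun t => ?_) (fun w t => by simpa using hx w t) w
        have := (norm_le_pi_norm y t).trans (mem_closedBall_zero_iff.1 hy)
        simpa using this
      · refine Fin.cases ?_ (fun w => ?_) w <;> refine Fin.cases ?_ (fun w' => ?_) w'
        · simp
        · intro _
          simpa using hyx w'
        · intro _
          simpa [norm_sub_rev] using hyx w
        · intro hne
          simpa using hsep w w' (fun h => hne (by rw [h]))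
  obtain ⟨x, hx, hsep⟩ := key _ le_rfl
  exact ⟨⌈V⌉₊, x, Nat.ceil_pos.2 hV0, Nat.le_ceil V, hx, hsep⟩

/-- Minimum-distance decoding corrects every noise vector of energy at most `2 * n`. -/
theorem exists_measurable_decoder {ι : Type*} [Fintype ι] [Nonempty ι] [MeasurableSpace ι]
    [MeasurableSingletonClass ι] {n : ℕ} (x : ι → Fin n → ℂ)
    (hx : ∀ w w', w ≠ w' → 8 * n < ∑ t, ‖x w t - x w' t‖ ^ 2) :
    ∃ dec : (Fin n → ℂ) → ι, Measurable dec ∧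
      ∀ w z, ∑ t, ‖z t‖ ^ 2 ≤ 2 * n → dec (x w + z) = w := by
  classical
  let D : ι → Set (Fin n → ℂ) := fun w => {y | ∑ t, ‖y t - x w t‖ ^ 2 ≤ 2 * n}
  have hD : ∀ w, MeasurableSet (D w) := fun w => by
    refine measurableSet_le ?_ measurable_const
    fun_prop
  have huniq : ∀ y w w', y ∈ D w → y ∈ D w' → w = w' := by
    intro y w w' hw hw'
    by_contra hne
    refine (hx w w' hne).not_ge ?_
    calc ∑ t, ‖x w t - x w' t‖ ^ 2
        ≤ ∑ t, (2 * ‖y t - x w t‖ ^ 2 + 2 * ‖y t - x w' t‖ ^ 2) := by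
          refine Finset.sum_le_sum fun t _ => ?_
          have h1 : ‖x w t - x w' t‖ ≤ ‖y t - x w t‖ + ‖y t - x w' t‖ := by
            have := norm_sub_le (y t - x w' t) (y t - x w t)
            rw [show y t - x w' t - (y t - x w t) = x w t - x w' t by ring] at this
            linarith
          have h2 := norm_nonneg (x w t - x w' t)
          nlinarith [sq_nonneg (‖y t - x w t‖ - ‖y t - x w' t‖)]
      _ = 2 * ∑ t, ‖y t - x w t‖ ^ 2 + 2 * ∑ t, ‖y t - x w' t‖ ^ 2 := by
          rw [Finset.sum_add_distrib, Finset.mul_sum, Finset.mul_sum]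
      _ ≤ 8 * n := by
          have h1 : ∑ t, ‖y t - x w t‖ ^ 2 ≤ 2 * n := hw
          have h2 : ∑ t, ‖y t - x w' t‖ ^ 2 ≤ 2 * n := hw'
          linarith
  obtain ⟨w₀⟩ := ‹Nonempty ι›
  let dec : (Fin n → ℂ) → ι := fun y => if h : ∃ w, y ∈ D w then h.choose else w₀
  have hdec : ∀ y w, y ∈ D w → dec y = w := by
    intro y w hy
    have h : ∃ w, y ∈ D w := ⟨w, hy⟩
    simp only [dec, dif_pos h]
    exact huniq y _ _ h.choose_spec hy
  refine ⟨dec, measurable_to_countable' fun w => ?_, fun w z hz => hdec _ _ ?_⟩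
  · have : dec ⁻¹' {w} = D w ∪ ((⋃ v, D v)ᶜ ∩ {_y | w = w₀}) := by
      ext y
      simp only [Set.mem_preimage, Set.mem_singleton_iff, Set.mem_union, Set.mem_inter_iff,
        Set.mem_compl_iff, Set.mem_iUnion, Set.mem_ofPred_eq]
      by_cases h : ∃ v, y ∈ D v
      · obtain ⟨v, hv⟩ := h
        rw [hdec y v hv]
        constructor
        · rintro rfl
          exact Or.inl hv
        · rintro (h | h)
          · exact huniq y _ _ hv h
          · exact absurd ⟨v, hv⟩ h.1
      · simp only [dec, dif_neg h, h, not_false_eq_true, true_and]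
        constructor
        · exact fun h' => Or.inr h'.symm
        · rintro (h' | h')
          · exact absurd ⟨w, h'⟩ h
          · exact h'.symm
    rw [this]
    exact (hD w).union ((MeasurableSet.iUnion hD).compl.inter (MeasurableSet.const _))
  · simpa [D] using hz

theorem integral_exp_gaussianReal :
    ∫ x, Real.exp (x ^ 2 / 2) ∂gaussianReal 0 (1 / 2 : ℝ≥0) = √2 := by
  rw [integral_gaussianReal_eq_integral_smul (by norm_num)]
  have h : ∀ x : ℝ, gaussianPDFReal 0 (1 / 2 : ℝ≥0) x • Real.exp (x ^ 2 / 2) =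
      √2 * gaussianPDFReal 0 1 x := by
    intro x
    simp only [gaussianPDFReal, smul_eq_mul]
    have h1 : √(2 * Real.pi * ((1 / 2 : ℝ≥0) : ℝ)) = √Real.pi := by
      congr 1; push_cast; ring
    have h2 : √(2 * Real.pi * ((1 : ℝ≥0) : ℝ)) = √2 * √Real.pi := by
      rw [← Real.sqrt_mul (by norm_num)]; simp
    rw [h1, h2, mul_assoc, ← Real.exp_add]
    have h3 : -(x - 0) ^ 2 / (2 * ((1 / 2 : ℝ≥0) : ℝ)) + x ^ 2 / 2 =
        -(x - 0) ^ 2 / (2 * ((1 : ℝ≥0) : ℝ)) := by push_cast; ring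
    rw [h3]
    have : √2 ≠ 0 := by positivity
    field_simp
  simp only [h]
  rw [integral_const_mul, integral_gaussianPDFReal_eq_one 0 (by norm_num), mul_one]

theorem integral_exp_complexGaussian :
    ∫ z, Real.exp (‖z‖ ^ 2 / 2) ∂complexGaussian = 2 := by
  rw [complexGaussian, integral_map measurable_complex_mk.aemeasurable (by fun_prop)]
  have h : ∀ p : ℝ × ℝ, Real.exp (‖(⟨p.1, p.2⟩ : ℂ)‖ ^ 2 / 2) =
      Real.exp (p.1 ^ 2 / 2) * Real.exp (p.2 ^ 2 / 2) := by
    intro p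
    rw [← Real.exp_add, Complex.sq_norm, Complex.normSq_apply]
    congr 1; ring
  simp only [h]
  rw [integral_prod_mul (fun x => Real.exp (x ^ 2 / 2)) (fun x => Real.exp (x ^ 2 / 2)),
    integral_exp_gaussianReal, Real.mul_self_sqrt (by norm_num)]

/-- Chernoff bound for the energy of the noise. -/
theorem noiseLaw_energy_le (n : ℕ) :
    noiseLaw n {z | ¬ ∑ t, ‖z t‖ ^ 2 ≤ 2 * n} ≤ ENNReal.ofReal ((2 / Real.exp 1) ^ n) := by
  have hint : ∫ z, ∏ t, Real.exp (‖z t‖ ^ 2 / 2) ∂noiseLaw n = 2 ^ n := by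
    rw [integral_fintype_prod_eq_prod (𝕜 := ℝ) (fun (_ : Fin n) z => Real.exp (‖z‖ ^ 2 / 2))]
    simp [integral_exp_complexGaussian]
  have hinteg : Integrable (fun z : Fin n → ℂ => ∏ t, Real.exp (‖z t‖ ^ 2 / 2)) (noiseLaw n) := by
    by_contra h
    rw [integral_undef h] at hint
    exact (by positivity : (2 : ℝ) ^ n ≠ 0) hint.symm
  have hmarkov := mul_meas_ge_le_integral_of_nonneg (μ := noiseLaw n)
    (ae_of_all _ fun z => by positivity) hinteg (Real.exp n)
  rw [hint] at hmarkov
  have hsub : {z : Fin n → ℂ | ¬ ∑ t, ‖z t‖ ^ 2 ≤ 2 * n} ⊆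
      {z | Real.exp n ≤ ∏ t, Real.exp (‖z t‖ ^ 2 / 2)} := by
    intro z hz
    simp only [Set.mem_ofPred_eq, not_le] at hz ⊢
    rw [← Real.exp_sum, Real.exp_le_exp, ← Finset.sum_div]
    linarith
  refine (measure_mono hsub).trans ?_
  rw [← ofReal_measureReal]
  refine ENNReal.ofReal_le_ofReal ?_
  rw [div_pow, ← Real.exp_nat_mul, mul_one, le_div_iff₀ (Real.exp_pos _), mul_comm]
  exact hmarkov

/-! ### Achievability by zero-forcing beams -/

/-- Zero-forcing beams for the transmit sets `T` and the set `A` of served users: the vector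
`fun k => v k i` is supported on `T i`, vanishes for `i ∉ A`, and is received with coefficient one
at receiver `i` and with coefficient zero at all other receivers in `A`. -/
structure IsBeamforming {K : ℕ} (T : Fin K → Finset (Fin K)) (G : Fin K → Fin K → ℂ)
    (A : Set (Fin K)) (v : Fin K → Fin K → ℂ) : Prop where
  support : ∀ k i, k ∉ T i → v k i = 0
  inactive : ∀ k i, i ∉ A → v k i = 0
  zeroForcing : ∀ j ∈ A, ∀ i ∈ A, ∑ k, G j k * v k i = if i = j then 1 else 0

/-- Every served user sends codewords of one sphere-packing codebook along its beam, and receives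
its own codeword without interference. -/
theorem IsBeamforming.exists_code {K : ℕ} {T : Fin K → Finset (Fin K)} {G : Fin K → Fin K → ℂ}
    {A : Set (Fin K)} {v : Fin K → Fin K → ℂ} (hv : IsBeamforming T G A v) {V : ℝ}
    (hV : ∀ k, ∑ i, ‖v k i‖ ≤ V) (hV0 : 0 < V) {P : ℝ} (hP : 0 < P) {n : ℕ} (hn : 0 < n) :
    ∃ c : Code K n, (∀ i ∈ A, (P / (8 * Real.exp 1 * V ^ 2)) ^ n ≤ (c.card i : ℝ)) ∧
      c.PowerConstraint T P ∧ c.IsZeroForcing T G ∧ (∀ j, c.Active T G j → j ∈ A) ∧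
      ∀ i, c.errorProb T G i ≤ ENNReal.ofReal ((2 / Real.exp 1) ^ n) := by
  classical
  obtain ⟨N, x, hN0, hN, hxα, hsep⟩ := exists_codebook n hn (α := √P / V) (by positivity)
  let card : Fin K → ℕ := fun i => if i ∈ A then N else 1
  have hcard_le : ∀ i, card i ≤ N := fun i => by
    simp only [card]
    split_ifs <;> omega
  have hcard_pos : ∀ i, 0 < card i := fun i => by
    simp only [card]
    split_ifs <;> omega
  let e : (i : Fin K) → Fin (card i) → Fin N := fun i => Fin.castLE (hcard_le i)
  have hne : ∀ i, Nonempty (Fin (card i)) := fun i => Fin.pos_iff_nonempty.1 (hcard_pos i)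
  have hdec := fun i => exists_measurable_decoder (fun w => x (e i w))
    fun w w' hww => hsep _ _ fun h => hww (Fin.castLE_injective (hcard_le i) h)
  choose dec hdec_meas hdec using hdec
  let c : Code K n :=
    { card := card
      card_pos := hcard_pos
      beam := fun k i w t => v k i * x (e i w) t
      dec := dec
      measurable_dec := hdec_meas }
  have hsub : ∀ i, i ∉ A → Subsingleton (Fin (c.card i)) := fun i hi => by
    have : c.card i = 1 := if_neg hi
    rw [this]
    infer_instance
  have htx : ∀ m k t, c.tx T m k t = ∑ i, v k i * x (e i (m i)) t := by
    intro m k t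
    simp only [Code.tx, Finset.sum_filter, c]
    refine Finset.sum_congr rfl fun i _ => ?_
    split_ifs with h
    · rfl
    · rw [hv.support k i h, zero_mul]
  have hnoiseless : ∀ j ∈ A, ∀ m, c.noiseless T G j m = x (e j (m j)) := by
    intro j hj m
    funext t
    simp only [Code.noiseless, htx, Finset.mul_sum]
    rw [Finset.sum_comm, Finset.sum_eq_single j]
    · simp only [← mul_assoc, ← Finset.sum_mul]
      rw [hv.zeroForcing j hj j hj, if_pos rfl, one_mul]
    · intro i _ hij
      simp only [← mul_assoc, ← Finset.sum_mul]
      by_cases hi : i ∈ A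
      · rw [hv.zeroForcing j hj i hi, if_neg hij, zero_mul]
      · simp [hv.inactive _ i hi]
    · simp
  have hnotactive : ∀ j, j ∉ A → ¬ c.Active T G j := by
    intro j hj
    have := hsub j hj
    rw [Code.not_active_iff]
    obtain ⟨w₀⟩ : Nonempty (Fin (c.card j)) := inferInstance
    have : (fun w : c.Msg => w j) = fun _ => w₀ := funext fun w => Subsingleton.elim _ _
    rw [this]
    exact indepFun_const_right _ _
  refine ⟨c, fun i hi => ?_, fun k => ?_, fun j => ?_, fun j hj => ?_, fun i => ?_⟩
  · have : c.card i = N := if_pos hi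
    rw [this]
    convert hN using 2
    rw [div_pow, Real.sq_sqrt hP.le]
    field_simp
  · have hpt : ∀ m, ∑ t, ‖c.tx T m k t‖ ^ 2 ≤ n * P := by
      intro m
      calc ∑ t, ‖c.tx T m k t‖ ^ 2 ≤ ∑ _t : Fin n, P := by
            refine Finset.sum_le_sum fun t _ => ?_
            rw [htx]
            have h1 : ‖∑ i, v k i * x (e i (m i)) t‖ ≤ √P := by
              calc _ ≤ ∑ i, ‖v k i * x (e i (m i)) t‖ := norm_sum_le _ _
                _ ≤ ∑ i, ‖v k i‖ * (√P / V) := by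
                    refine Finset.sum_le_sum fun i _ => ?_
                    rw [norm_mul]
                    gcongr
                    exact hxα _ _
                _ = (∑ i, ‖v k i‖) * (√P / V) := by rw [Finset.sum_mul]
                _ ≤ V * (√P / V) := by
                    gcongr
                    exact hV k
                _ = √P := by field_simp
            calc _ ≤ √P ^ 2 := by gcongr
              _ = P := Real.sq_sqrt hP.le
        _ = n * P := by simp
    calc ∫ m, ∑ t, ‖c.tx T m k t‖ ^ 2 ∂c.msgLaw ≤ ∫ _m, (n * P : ℝ) ∂c.msgLaw :=
          integral_mono Integrable.of_finite Integrable.of_finite hpt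
      _ = n * P := by simp
  · by_cases hj : j ∈ A
    · exact Or.inr ⟨fun w => x (e j w), hnoiseless j hj⟩
    · have := hnotactive j hj
      rw [Code.Active, not_lt, nonpos_iff_eq_zero] at this
      exact Or.inl this
  · by_contra h
    exact hnotactive j h hj
  · refine le_trans ?_ (noiseLaw_energy_le n)
    have hincl : {p : c.Msg × (Fin n → ℂ) | c.dec i (c.noiseless T G i p.1 + p.2) ≠ p.1 i} ⊆
        Set.univ ×ˢ {z | ¬ ∑ t, ‖z t‖ ^ 2 ≤ 2 * n} := by
      rintro ⟨m, z⟩ hp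
      refine ⟨Set.mem_univ _, fun hz => hp ?_⟩
      by_cases hi : i ∈ A
      · simp only [hnoiseless i hi]
        exact hdec i (m i) z hz
      · have := hsub i hi
        exact Subsingleton.elim _ _
    refine (measure_mono hincl).trans ?_
    rw [Measure.prod_prod, measure_univ, one_mul]

theorem IsBeamforming.exists_rates {K : ℕ} {T : Fin K → Finset (Fin K)} {G : Fin K → Fin K → ℂ}
    {A : Set (Fin K)} [DecidablePred (· ∈ A)] {v : Fin K → Fin K → ℂ} (hv : IsBeamforming T G A v) :
    ∃ R : ℝ → Fin K → ℝ, (∀ P > 0, ZFRatesAchievable T G A P (R P)) ∧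
      ∀ i, Tendsto (fun P => R P i / Real.log P) atTop (𝓝 (if i ∈ A then 1 else 0)) := by
  let V : ℝ := ∑ k, ∑ i, ‖v k i‖ + 1
  have hV0 : 0 < V := by positivity
  have hV : ∀ k, ∑ i, ‖v k i‖ ≤ V := fun k =>
    (Finset.single_le_sum (f := fun k => ∑ i, ‖v k i‖) (fun k _ => by positivity)
      (Finset.mem_univ k)).trans (le_add_of_nonneg_right zero_le_one)
  let b : ℝ := 8 * Real.exp 1 * V ^ 2
  have hb : 0 < b := by positivity
  refine ⟨fun P i => if i ∈ A then max 0 (Real.log (P / b)) else 0, fun P hP ε hε => ?_,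
    fun i => ?_⟩
  · have hlt : (2 / Real.exp 1) < 1 := by
      rw [div_lt_one (Real.exp_pos 1)]
      linarith [Real.exp_one_gt_d9]
    have hlim : Tendsto (fun n : ℕ => ENNReal.ofReal ((2 / Real.exp 1) ^ n)) atTop (𝓝 0) := by
      have := ENNReal.tendsto_ofReal
        (tendsto_pow_atTop_nhds_zero_of_lt_one (by positivity : (0 : ℝ) ≤ 2 / Real.exp 1) hlt)
      simpa using this
    obtain ⟨N, hN⟩ := eventually_atTop.1 (hlim.eventually_le_const hε)
    refine ⟨max N 1, fun n hn => ?_⟩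
    obtain ⟨c, hcard, hpow, hzf, hact, herr⟩ :=
      hv.exists_code hV hV0 hP (n := n) (by have := le_of_max_le_right hn; omega)
    refine ⟨c, fun i => ?_, hpow, hzf, hact,
      fun i => (herr i).trans (hN n (le_of_max_le_left hn))⟩
    have h1 : (1 : ℝ) ≤ c.card i := by exact_mod_cast c.card_pos i
    dsimp only
    split_ifs with hi
    · rcases max_cases (0 : ℝ) (Real.log (P / b)) with ⟨h, -⟩ | ⟨h, -⟩
      · rw [h]
        simpa using h1
      · rw [h, Real.exp_nat_mul, Real.exp_log (by positivity)]
        exact hcard i hi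
    · simpa using h1
  · by_cases hi : i ∈ A
    · simp only [hi, if_true]
      have h1 : Tendsto (fun P => 1 - Real.log b / Real.log P) atTop (𝓝 (1 - 0)) :=
        tendsto_const_nhds.sub (Tendsto.div_atTop tendsto_const_nhds Real.tendsto_log_atTop)
      rw [sub_zero] at h1
      refine h1.congr' ?_
      filter_upwards [eventually_gt_atTop 1, eventually_gt_atTop b] with P hP hPb
      have hlog : 0 < Real.log P := Real.log_pos hP
      have hge : 0 ≤ Real.log (P / b) := Real.log_nonneg ((one_le_div hb).2 hPb.le)
      rw [max_eq_right hge, Real.log_div (by linarith) hb.ne', sub_div, div_self hlog.ne']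
    · simp [hi]

/-! ### The block scheme -/

/-- Position of a served receiver in block `q` of `2 * M + L` users: the first `M` receivers of the
block (`h = false`) and the last `M` receivers (`h = true`). -/
def rxPos (L M q : ℕ) (h : Bool) (p : ℕ) : ℕ := q * (2 * M + L) + (if h then M + L else 0) + p

/-- Position of a transmitter in use in block `q`: two groups of `M` consecutive transmitters. The
offset `b` keeps the receivers connected to them inside the block. -/
def txPos (L M b q : ℕ) (h : Bool) (p : ℕ) : ℕ :=
  q * (2 * M + L) + b + (if h then M else 0) + p

/-- Served receivers hear transmitters of their own group only, and within a group the connections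
are triangular. -/
theorem conn_rxPos_txPos {a b M q q' p p' : ℕ} {h h' : Bool} (hp : p < M) (hp' : p' < M)
    (hc : Conn a b (rxPos (a + b) M q h p) (txPos (a + b) M b q' h' p')) :
    q = q' ∧ h = h' ∧ (h = false → p' ≤ p) ∧ (h = true → p ≤ p') := by
  obtain ⟨h1, h2⟩ := hc
  unfold rxPos txPos at h1 h2
  have hq : q = q' := by
    rcases lt_trichotomy q q' with hlt | heq | hlt
    · have := Nat.mul_le_mul_right (2 * M + (a + b)) (Nat.succ_le_of_lt hlt)
      rw [Nat.succ_mul] at this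
      split_ifs at h1 h2 <;> omega
    · exact heq
    · have := Nat.mul_le_mul_right (2 * M + (a + b)) (Nat.succ_le_of_lt hlt)
      rw [Nat.succ_mul] at this
      split_ifs at h1 h2 <;> omega
  subst hq
  cases h <;> cases h' <;> simp at h1 h2 ⊢ <;> omega

theorem conn_rxPos_txPos_self (a b M q p : ℕ) (h : Bool) :
    Conn a b (rxPos (a + b) M q h p) (txPos (a + b) M b q h p) := by
  unfold Conn rxPos txPos
  split_ifs <;> omega

theorem rxPos_lt {L M Q q p : ℕ} {h : Bool} (hq : q < Q) (hp : p < M) :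
    rxPos L M q h p < Q * (2 * M + L) := by
  have := Nat.mul_le_mul_right (2 * M + L) (Nat.succ_le_of_lt hq)
  rw [Nat.succ_mul] at this
  unfold rxPos
  split_ifs <;> omega

theorem txPos_lt {a b M Q q p : ℕ} {h : Bool} (hq : q < Q) (hp : p < M) :
    txPos (a + b) M b q h p < Q * (2 * M + (a + b)) := by
  have := Nat.mul_le_mul_right (2 * M + (a + b)) (Nat.succ_le_of_lt hq)
  rw [Nat.succ_mul] at this
  unfold txPos
  split_ifs <;> omega

theorem rxPos_injective {L M q q' p p' : ℕ} {h h' : Bool} (hp : p < M) (hp' : p' < M)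
    (heq : rxPos L M q h p = rxPos L M q' h' p') : q = q' ∧ h = h' ∧ p = p' := by
  unfold rxPos at heq
  have hq : q = q' := by
    rcases lt_trichotomy q q' with hlt | h | hlt
    · have := Nat.mul_le_mul_right (2 * M + L) (Nat.succ_le_of_lt hlt)
      rw [Nat.succ_mul] at this
      split_ifs at heq <;> omega
    · exact h
    · have := Nat.mul_le_mul_right (2 * M + L) (Nat.succ_le_of_lt hlt)
      rw [Nat.succ_mul] at this
      split_ifs at heq <;> omega
  subst hq
  cases h <;> cases h' <;> simp at heq ⊢ <;> omega

section Scheme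

variable {a b M Q K : ℕ} (hQ : Q * (2 * M + (a + b)) ≤ K)

/-- The served receivers of the block scheme. -/
def rx (x : Fin Q × Bool × Fin M) : Fin K :=
  ⟨rxPos (a + b) M x.1 x.2.1 x.2.2, (rxPos_lt x.1.2 x.2.2.2).trans_le hQ⟩

/-- The transmitters in use in the block scheme. -/
def tm (x : Fin Q × Bool × Fin M) : Fin K :=
  ⟨txPos (a + b) M b x.1 x.2.1 x.2.2, (txPos_lt x.1.2 x.2.2.2).trans_le hQ⟩

theorem rx_injective : Function.Injective (rx hQ) := by
  rintro ⟨q, h, p⟩ ⟨q', h', p'⟩ heq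
  obtain ⟨h1, h2, h3⟩ := rxPos_injective p.2 p'.2 (Fin.ext_iff.1 heq)
  ext
  · exact h1
  · rw [show h = h' from h2]
  · exact h3

/-- The transmit sets of the block scheme: a served user is served by the `M` transmitters of its
group. -/
def schemeT (i : Fin K) : Finset (Fin K) :=
  Finset.univ.filter fun k => ∃ q h p p', rx hQ (q, h, p) = i ∧ tm hQ (q, h, p') = k

theorem card_schemeT_le (i : Fin K) : (schemeT hQ i).card ≤ M := by
  classical
  by_cases hi : ∃ x, rx hQ x = i
  · obtain ⟨⟨q, h, p⟩, rfl⟩ := hi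
    have hsub : schemeT hQ (rx hQ (q, h, p)) ⊆
        Finset.univ.image fun p' => tm hQ (q, h, p') := by
      intro k hk
      obtain ⟨q', h', p'', p', h1, rfl⟩ := (Finset.mem_filter.1 hk).2
      have := rx_injective hQ h1
      simp only [Prod.mk.injEq] at this
      obtain ⟨rfl, rfl, -⟩ := this
      exact Finset.mem_image_of_mem _ (Finset.mem_univ _)
    exact (Finset.card_le_card hsub).trans (Finset.card_image_le.trans (by simp))
  · have : schemeT hQ i = ∅ := by
      refine Finset.filter_eq_empty_iff.2 ?_
      rintro k - ⟨q, h, p, p', h1, -⟩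
      exact hi ⟨_, h1⟩
    simp [this]

/-- The channel matrix of one group of `M` transmitters and `M` receivers. -/
def groupMatrix (H : Fin K → Fin K → ℂ) (q : Fin Q) (h : Bool) : Matrix (Fin M) (Fin M) ℂ :=
  fun p p' => localChannel a b H (rx hQ (q, h, p)) (tm hQ (q, h, p'))

/-- The matrix of a group is triangular with nonzero diagonal. -/
theorem isUnit_det_groupMatrix {H : Fin K → Fin K → ℂ} (hH : ∀ i j, H i j ≠ 0) (q : Fin Q)
    (h : Bool) : IsUnit (groupMatrix hQ H q h).det := by
  have hdiag : ∏ p, groupMatrix hQ H q h p p ≠ 0 := by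
    refine Finset.prod_ne_zero_iff.2 fun p _ => ?_
    have hc := conn_rxPos_txPos_self a b M q p h
    have : groupMatrix hQ H q h p p = H (rx hQ (q, h, p)) (tm hQ (q, h, p)) := if_pos hc
    rw [this]
    exact hH _ _
  have htri : ∀ p p', ¬ ((h = false → p' ≤ p) ∧ (h = true → p ≤ p')) →
      groupMatrix hQ H q h p p' = 0 := fun p p' hn =>
    localChannel_eq_zero H fun hc => hn (by
      have := (conn_rxPos_txPos p.2 p'.2 hc).2.2
      exact ⟨fun h0 => this.1 h0, fun h0 => this.2 h0⟩)
  rw [isUnit_iff_ne_zero]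
  cases h with
  | false =>
    rw [Matrix.det_of_isLowerTriangular _ fun p p' hlt => htri p p' ?_]
    · exact hdiag
    · have hlt' : p < p' := hlt
      simpa using hlt'
  | true =>
    rw [Matrix.det_of_isUpperTriangular fun p p' hlt => htri p p' ?_]
    · exact hdiag
    · have hlt' : p' < p := hlt
      simpa using hlt'

open Classical in
/-- The beams of the block scheme, columns of the inverse group matrices. -/
noncomputable def schemeBeam (H : Fin K → Fin K → ℂ) (k i : Fin K) : ℂ :=
  ∑ x : Fin Q × Bool × Fin M, if rx hQ x = i then
    ∑ p', if tm hQ (x.1, x.2.1, p') = k then (groupMatrix hQ H x.1 x.2.1)⁻¹ p' x.2.2 else 0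
  else 0

theorem isBeamforming_schemeBeam {H : Fin K → Fin K → ℂ} (hH : ∀ i j, H i j ≠ 0) :
    IsBeamforming (schemeT hQ) (localChannel a b H) (Set.range (rx hQ)) (schemeBeam hQ H) := by
  classical
  refine ⟨fun k i hk => ?_, fun k i hi => ?_, ?_⟩
  · refine Finset.sum_eq_zero fun x _ => ?_
    split_ifs with hx
    · refine Finset.sum_eq_zero fun p' _ => if_neg fun hp' => hk ?_
      exact Finset.mem_filter.2 ⟨Finset.mem_univ _, x.1, x.2.1, x.2.2, p', hx, hp'⟩
    · rfl
  · exact Finset.sum_eq_zero fun x _ => if_neg fun hx => hi ⟨x, hx⟩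
  · rintro _ ⟨⟨q, h, p⟩, rfl⟩ _ ⟨⟨q', h', p'⟩, rfl⟩
    have hbeam : ∀ k, schemeBeam hQ H k (rx hQ (q', h', p')) =
        ∑ r, if tm hQ (q', h', r) = k then (groupMatrix hQ H q' h')⁻¹ r p' else 0 := by
      intro k
      unfold schemeBeam
      rw [Finset.sum_eq_single (q', h', p')]
      · simp
      · intro x _ hx
        exact if_neg fun h0 => hx (rx_injective hQ h0)
      · simp
    have hsum : ∑ k, localChannel a b H (rx hQ (q, h, p)) k *
        schemeBeam hQ H k (rx hQ (q', h', p')) =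
        ∑ r, localChannel a b H (rx hQ (q, h, p)) (tm hQ (q', h', r)) *
          (groupMatrix hQ H q' h')⁻¹ r p' := by
      simp only [hbeam, Finset.mul_sum]
      rw [Finset.sum_comm]
      refine Finset.sum_congr rfl fun r _ => ?_
      simp
    rw [hsum]
    by_cases hgroup : q = q' ∧ h = h'
    · obtain ⟨rfl, rfl⟩ := hgroup
      have hinv := congrFun (congrFun
        (Matrix.mul_nonsing_inv _ (isUnit_det_groupMatrix hQ hH q h)) p) p'
      rw [Matrix.mul_apply, Matrix.one_apply] at hinv
      refine Eq.trans hinv ?_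
      simp [(rx_injective hQ).eq_iff, eq_comm]
    · have hne : rx hQ (q', h', p') ≠ rx hQ (q, h, p) := fun h0 => hgroup (by
        have := rx_injective hQ h0
        simp only [Prod.mk.injEq] at this
        exact ⟨this.1.symm, this.2.1.symm⟩)
      rw [if_neg hne]
      refine Finset.sum_eq_zero fun r _ => ?_
      rw [localChannel_eq_zero H, zero_mul]
      intro hc
      have := conn_rxPos_txPos p.2 r.2 hc
      exact hgroup ⟨Fin.ext this.1, this.2.1⟩

theorem zfDoFAchievable_scheme {μ : Measure ℂ} [IsProbabilityMeasure μ] [NullSingletonClass μ] :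
    ZFDoFAchievable a b μ (schemeT hQ)
      (fun i => if i ∈ Set.range (rx hQ) then (1 : ℝ) else 0) := by
  refine ⟨fun i => ?_, ?_⟩
  · by_cases hi : i ∈ Set.range (rx hQ)
    · exact Or.inr (if_pos hi)
    · exact Or.inl (if_neg hi)
  · filter_upwards [ae_coeffLaw_algebraicIndependent K μ] with H hH
    have hset : {i | (if i ∈ Set.range (rx hQ) then (1 : ℝ) else 0) = 1} = Set.range (rx hQ) := by
      ext i
      rw [Set.mem_ofPred_eq]
      split_ifs with hi <;> simp [hi]
    rw [hset]
    exact (isBeamforming_schemeBeam hQ fun i j => hH.ne_zero (i, j)).exists_rates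

theorem sum_dof_scheme :
    ∑ i, (if i ∈ Set.range (rx hQ) then (1 : ℝ) else 0) = 2 * M * Q := by
  have h1 : (Finset.univ.filter fun i => i ∈ Set.range (rx hQ)) =
      Finset.univ.image (rx hQ) := by
    ext i
    simp
  rw [Finset.sum_boole, h1, Finset.card_image_of_injective _ (rx_injective hQ)]
  simp
  ring

end Scheme

/-! ### The degrees of freedom -/

theorem zfDoF_bounds {a b M : ℕ} (hN : 0 < 2 * M + (a + b)) (μ : Measure ℂ)
    [IsProbabilityMeasure μ] [NullSingletonClass μ] (K : ℕ) :
    2 * M * ((K / (2 * M + (a + b)) : ℕ) : ℝ) ≤ zfDoF a b M μ K ∧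
      zfDoF a b M μ K ≤ 2 * M * (((K / (2 * M + (a + b)) : ℕ) : ℝ) + 1) := by
  classical
  have hQ := Nat.div_mul_le_self K (2 * M + (a + b))
  have hub : ∀ s ∈ {s | ∃ (T : Fin K → Finset (Fin K)) (d : Fin K → ℝ),
      (∀ i, (T i).card ≤ M) ∧ ZFDoFAchievable a b μ T d ∧ s = ∑ i, d i},
      s ≤ 2 * M * (((K / (2 * M + (a + b)) : ℕ) : ℝ) + 1) := by
    rintro s ⟨T, d, hT, hd, rfl⟩
    exact sum_dof_le hN hT hd
  have hmem : 2 * M * ((K / (2 * M + (a + b)) : ℕ) : ℝ) ∈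
      {s | ∃ (T : Fin K → Finset (Fin K)) (d : Fin K → ℝ),
      (∀ i, (T i).card ≤ M) ∧ ZFDoFAchievable a b μ T d ∧ s = ∑ i, d i} :=
    ⟨_, _, card_schemeT_le hQ, zfDoFAchievable_scheme hQ, (sum_dof_scheme hQ).symm⟩
  exact ⟨le_csSup ⟨_, hub⟩ hmem, csSup_le ⟨_, hmem⟩ hub⟩

theorem tendsto_zfDoF_div {a b M : ℕ} (hN : 0 < 2 * M + (a + b)) (μ : Measure ℂ)
    [IsProbabilityMeasure μ] [NullSingletonClass μ] :
    Tendsto (fun K : ℕ => zfDoF a b M μ K / K) atTop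
      (𝓝 ((2 * M : ℝ) / (2 * M + (a + b : ℕ)))) := by
  have hN' : (0 : ℝ) < 2 * M + (a + b : ℕ) := by exact_mod_cast hN
  have h0 : Tendsto (fun K : ℕ => (2 * M : ℝ) / K) atTop (𝓝 0) :=
    tendsto_const_div_atTop_nhds_zero_nat _
  have hlow := (tendsto_const_nhds (x := (2 * M : ℝ) / (2 * M + (a + b : ℕ)))).sub h0
  have hupp := (tendsto_const_nhds (x := (2 * M : ℝ) / (2 * M + (a + b : ℕ)))).add h0
  rw [sub_zero] at hlow
  rw [add_zero] at hupp
  have hdiv : ∀ K : ℕ, (K : ℝ) / (2 * M + (a + b : ℕ)) - 1 ≤ ((K / (2 * M + (a + b)) : ℕ) : ℝ) ∧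
      ((K / (2 * M + (a + b)) : ℕ) : ℝ) ≤ (K : ℝ) / (2 * M + (a + b : ℕ)) := by
    intro K
    have h1 : ((2 * M + (a + b) : ℕ) : ℝ) = 2 * M + (a + b : ℕ) := by push_cast; ring
    constructor
    · rw [sub_le_iff_le_add, div_le_iff₀ hN', ← h1]
      have := Nat.lt_mul_div_succ K hN
      rw [mul_comm] at this
      exact_mod_cast this.le
    · rw [← h1]
      exact Nat.cast_div_le
  refine tendsto_of_tendsto_of_tendsto_of_le_of_le' hlow hupp ?_ ?_
  · filter_upwards [eventually_gt_atTop 0] with K hK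
    have hK' : (0 : ℝ) < K := by exact_mod_cast hK
    rw [le_div_iff₀ hK']
    calc (2 * M / (2 * M + (a + b : ℕ)) - 2 * M / K) * K
        = 2 * M * ((K : ℝ) / (2 * M + (a + b : ℕ)) - 1) := by field_simp
      _ ≤ 2 * M * ((K / (2 * M + (a + b)) : ℕ) : ℝ) := by
          gcongr
          exact (hdiv K).1
      _ ≤ _ := (zfDoF_bounds hN μ K).1
  · filter_upwards [eventually_gt_atTop 0] with K hK
    have hK' : (0 : ℝ) < K := by exact_mod_cast hK
    rw [div_le_iff₀ hK']
    calc zfDoF a b M μ K ≤ 2 * M * (((K / (2 * M + (a + b)) : ℕ) : ℝ) + 1) :=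
          (zfDoF_bounds hN μ K).2
      _ ≤ 2 * M * ((K : ℝ) / (2 * M + (a + b : ℕ)) + 1) := by
          gcongr
          exact (hdiv K).2
      _ = _ := by field_simp

end CoMP

theorem mainTheorem7 (L M : ℕ) (hL : 1 ≤ L) (hM : 1 ≤ M)
    (a b : ℕ) (hab : a + b = L)
    (μ : Measure ℂ) [IsProbabilityMeasure μ] [NullSingletonClass μ] :
    -- the asymptotic per user DoF under zero-forcing
    Tendsto (fun K : ℕ => CoMP.zfDoF a b M μ K / K) atTop
      (𝓝 ((2 * M : ℝ) / (2 * M + L))) ∧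
    -- in each channel use, `2 * M + L` consecutive users contain at most `2 * M` active ones
    ∀ K : ℕ, ∀ᵐ H ∂CoMP.coeffLaw K μ, ∀ T : Fin K → Finset (Fin K), (∀ i, (T i).card ≤ M) →
      ∀ (n : ℕ) (c : CoMP.Code K n), c.IsZeroForcing T (CoMP.localChannel a b H) →
        ∀ (t : Fin n) (s : ℕ),
          {j : Fin K | s ≤ (j : ℕ) ∧ (j : ℕ) < s + (2 * M + L) ∧
            c.ActiveAt T (CoMP.localChannel a b H) t j}.ncard ≤ 2 * M := by
  subst hab
  refine ⟨CoMP.tendsto_zfDoF_div (by omega) μ, fun K => ?_⟩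
  filter_upwards [CoMP.ae_coeffLaw_algebraicIndependent K μ] with H hH T hT n c hc t s
  exact CoMP.Code.card_activeAt_window_le hH hT hc t s
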